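/- Let $S\subseteq\mathbb N$ be a numerical semigroup (an additive submonoid with finite complement) minimally generated by four odd integers $n_1,n_2,n_3,n_4$. Let $F(S)=\max(\mathbb Z\setminus S)$, $g(S)=|\mathbb N\setminus S|$, let $\mathrm{PF}(S)$ be the set of all $f\in\mathbb Z\setminus S$ with $f+s\in S$ for every $s\in S\setminus\{0\}$, and let $t(S)=|\mathrm{PF}(S)|$ be the type of $S$. Assume that $S$ is almost symmetric, i.e. $2g(S)=F(S)+t(S)$, and that $t(S)=3$. Let $\alpha_i$ be the least positive integer $\alpha$ such that $\alpha n_i$ is a linear combination of the $n_j$, $j\ne i$, with coefficients in $\mathbb N$. Then, after a suitable reordering of $n_1,\dots,n_4$ (and the same reordering of the $\alpha_i$), all $\alpha_i$ are odd and $$n_1=(\alpha_2-1)(\alpha_3-1)\alpha_4+\alpha_2,\qquad n_2=(\alpha_3-1)(\alpha_4-1)\alpha_1+\alpha_3,$$ $$n_3=(\alpha_4-1)(\alpha_1-1)\alpha_2+\alpha_4,\qquad n_4=(\alpha_1-1)(\alpha_2-1)\alpha_3+\alpha_1,$$ and for every field $k$, with $A=k[x_1,x_2,x_3,x_4]$ graded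 by $\deg x_i=n_i$, the following holds. The defining ideal $I_S=\ker(A\to k[t],\ x_i\mapsto t^{n_i})$ is generated by the six binomials $$f_1=x_1^{\alpha_1}-x_2^{\alpha_2-1}x_4,\quad f_2=x_2^{\alpha_2}-x_3^{\alpha_3-1}x_1,\quad f_3=x_3^{\alpha_3}-x_4^{\alpha_4-1}x_2,$$ $$f_4=x_4^{\alpha_4}-x_1^{\alpha_1-1}x_3,\quad f_5=x_1^{\alpha_1-1}x_2-x_3^{\alpha_3-1}x_4,\quad f_6=x_1x_4^{\alpha_4-1}-x_2^{\alpha_2-1}x_3,$$ and the minimal graded free resolution of $A/I_S$ is $$0\longrightarrow A^3\xrightarrow{\ \varphi_3\ }A^8\xrightarrow{\ \varphi_2\ }A^6\xrightarrow{\ \varphi_1\ }A\longrightarrow 0,$$ where $\varphi_1=(f_1,f_2,f_3,f_4,f_5,-f_6)$, $$\varphi_2=\begin{pmatrix} x_3^{\alpha_3-1}& x_2 & 0 & 0 & 0 & 0 & x_4^{\alpha_4-1} & x_3\\ x_1^{\alpha_1-1}& x_4 & 0 & 0 &x_4^{\alpha_4-1} & x_3 & 0 & 0\\ 0 & 0 &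 x_1^{\alpha_1-1} & x_4 & x_2^{\alpha_2-1}& x_1 & 0 & 0\\ 0 & 0 & x_3^{\alpha_3-1} & x_2 & 0 & 0 & x_2^{\alpha_2-1} & x_1\\ -x_2^{\alpha_2-1} & -x_1 & x_4^{\alpha_4-1} & x_3 & 0 & 0 & 0 & 0\\ 0 & 0 & 0 & 0 & -x_3^{\alpha_3-1} & -x_2 & x_1^{\alpha_1-1} & x_4 \end{pmatrix},$$ $${}^t\varphi_3=\begin{pmatrix} 0 & x_3 & 0 & x_1 & 0 & -x_4 & 0 & -x_2\\ x_4^{\alpha_4-1} & 0 & x_2^{\alpha_2-1} & 0 & -x_1^{\alpha_1-1} & 0 & -x_3^{\alpha_3-1} & 0\\ -x_3 & -x_4^{\alpha_4-1} & -x_1 & -x_2^{\alpha_2-1} & x_4 & x_1^{\alpha_1-1} & x_2 & x_3^{\alpha_3-1} \end{pmatrix}.$$ That is, the sequence, continued by the projection $A\to A/I_S$, is exact; with suitable degree shifts of the free modules the maps are homogeneous of degree $0$; and all entries of $\varphi_1,\varphi_2,\varphi_3$ lie in $(x_1,x_2,x_3,x_4)$. -/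

import Mathlib

open MvPolynomial

/-- A numerical semigroup: an additive submonoid of `ℕ` with finite complement. -/
def IsNumericalSemigroup (S : AddSubmonoid ℕ) : Prop :=
  {a : ℕ | a ∉ S}.Finite

/-- `S`, regarded as a subset of `ℤ`. -/
def intPoints (S : AddSubmonoid ℕ) : Set ℤ :=
  (fun a : ℕ => (a : ℤ)) '' (S : Set ℕ)

/-- The Frobenius number `F(S)`, the maximum of `ℤ \ S`. -/
noncomputable def frobeniusNumber (S : AddSubmonoid ℕ) : ℤ :=
  sSup {z : ℤ | z ∉ intPoints S}

/-- The supremum in the definition of `F(S)` is a maximum for every numerical semigroup. -/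
theorem isGreatest_frobeniusNumber (S : AddSubmonoid ℕ) (hS : IsNumericalSemigroup S) :
    IsGreatest {z : ℤ | z ∉ intPoints S} (frobeniusNumber S) := by
  have hne : {z : ℤ | z ∉ intPoints S}.Nonempty := by
    refine ⟨-1, ?_⟩
    rintro ⟨a, -, ha⟩
    simp only at ha
    omega
  have hbd : BddAbove {z : ℤ | z ∉ intPoints S} := by
    obtain ⟨N, hN⟩ := Set.Finite.bddAbove hS
    refine ⟨(N : ℤ), fun z hz => ?_⟩
    by_contra hlt
    push Not at hlt
    have hmem : z.toNat ∈ S := by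
      by_contra hn
      have := hN hn
      omega
    exact hz ⟨z.toNat, hmem, by simp only; omega⟩
  exact ⟨Int.csSup_mem hne hbd, fun z hz => le_csSup hbd hz⟩

/-- The set `PF(S)` of pseudo-Frobenius numbers: integers `f ∉ S` with `f + s ∈ S` for every
`s ∈ S \ {0}`. -/
def pseudoFrobenius (S : AddSubmonoid ℕ) : Set ℤ :=
  {f : ℤ | f ∉ intPoints S ∧ ∀ s ∈ S, s ≠ 0 → f + (s : ℤ) ∈ intPoints S}

/-- The type `t(S)`, the number of pseudo-Frobenius numbers. -/
noncomputable def semigroupType (S : AddSubmonoid ℕ) : ℕ :=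
  (pseudoFrobenius S).ncard

/-- The genus `g(S)`, the number of elements of `ℕ \ S`. -/
noncomputable def genus (S : AddSubmonoid ℕ) : ℕ :=
  {a : ℕ | a ∉ S}.ncard

/-- `S` is almost symmetric if `2 g(S) = F(S) + t(S)`. -/
def IsAlmostSymmetric (S : AddSubmonoid ℕ) : Prop :=
  2 * (genus S : ℤ) = frobeniusNumber S + (semigroupType S : ℤ)

/-- The submonoid of `ℕ` generated by the `n j` with `j ≠ i`. -/
def spanOthers {e : ℕ} (n : Fin e → ℕ) (i : Fin e) : AddSubmonoid ℕ :=
  AddSubmonoid.closure (n '' {j | j ≠ i})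

/-- `n 0, …, n (e - 1)` is the minimal system of generators of `S`. -/
def IsMinimalGenerators {e : ℕ} (S : AddSubmonoid ℕ) (n : Fin e → ℕ) : Prop :=
  S = AddSubmonoid.closure (Set.range n) ∧ ∀ i, n i ∉ spanOthers n i

/-- `α_i`, the least positive integer `a` such that `a * n i` is a combination, with coefficients
in `ℕ`, of the `n j` with `j ≠ i`. -/
noncomputable def alphaNumber {e : ℕ} (n : Fin e → ℕ) (i : Fin e) : ℕ :=
  sInf {a : ℕ | 0 < a ∧ a * n i ∈ spanOthers n i}

/-- The defining ideal of `⟨n 0, …, n (e - 1)⟩` over `k`: the kernel of the presentation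
`k[x_0, …, x_{e-1}] → k[t]`, `x_i ↦ t ^ (n i)`, whose image is the semigroup ring `k[S]`. -/
noncomputable def definingIdeal (k : Type*) [Field k] {e : ℕ} (n : Fin e → ℕ) :
    Ideal (MvPolynomial (Fin e) k) :=
  RingHom.ker (aeval (fun i => (Polynomial.X : Polynomial k) ^ n i) :
    MvPolynomial (Fin e) k →ₐ[k] Polynomial k)

/-- The entries of `M` are homogeneous, for `deg x_i = w i`, in such a way that `M` defines a
degree-preserving map from the graded free module with basis elements in the degrees `d'` to the
one with basis elements in the degrees `d`. -/
def IsGradedMatrix {k : Type*} [Field k] {e p q : ℕ} (w : Fin e → ℕ) (d : Fin p → ℕ)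
    (d' : Fin q → ℕ) (M : Matrix (Fin p) (Fin q) (MvPolynomial (Fin e) k)) : Prop :=
  ∀ i j, M i j = 0 ∨ ∃ c : ℕ, c + d i = d' j ∧ IsWeightedHomogeneous w (M i j) c

/-- `0 → A^{b₃} → A^{b₂} → A^{b₁} → A`, with the maps given by the matrices `φ₃`, `φ₂`, `φ₁`
acting on column vectors, is a minimal graded free resolution of `A / I`, where
`A = k[x_0, …, x_{e-1}]` is graded by `deg x_i = w i`. -/
structure IsMinimalFreeResolution {k : Type*} [Field k] {e b₁ b₂ b₃ : ℕ} (w : Fin e → ℕ)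
    (I : Ideal (MvPolynomial (Fin e) k))
    (φ₁ : Matrix (Fin 1) (Fin b₁) (MvPolynomial (Fin e) k))
    (φ₂ : Matrix (Fin b₁) (Fin b₂) (MvPolynomial (Fin e) k))
    (φ₃ : Matrix (Fin b₂) (Fin b₃) (MvPolynomial (Fin e) k)) : Prop where
  /-- Exactness at `A`, where `A → A / I` is the canonical projection. -/
  exact₀ : Function.Exact φ₁.mulVecLin
    (fun v : Fin 1 → MvPolynomial (Fin e) k => Ideal.Quotient.mk I (v 0))
  /-- Exactness at `A^{b₁}`. -/
  exact₁ : Function.Exact φ₂.mulVecLin φ₁.mulVecLin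
  /-- Exactness at `A^{b₂}`. -/
  exact₂ : Function.Exact φ₃.mulVecLin φ₂.mulVecLin
  /-- Exactness at `A^{b₃}`. -/
  injective₃ : Function.Injective φ₃.mulVecLin
  /-- The maps are homogeneous of degree zero for suitable shifts of the free modules. -/
  graded : ∃ (d₁ : Fin b₁ → ℕ) (d₂ : Fin b₂ → ℕ) (d₃ : Fin b₃ → ℕ),
    IsGradedMatrix w (fun _ => 0) d₁ φ₁ ∧ IsGradedMatrix w d₁ d₂ φ₂ ∧ IsGradedMatrix w d₂ d₃ φ₃
  /-- Minimality: all the entries lie in the ideal generated by the variables. -/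
  minimal₁ : ∀ i j, φ₁ i j ∈ Ideal.span (Set.range (X : Fin e → MvPolynomial (Fin e) k))
  minimal₂ : ∀ i j, φ₂ i j ∈ Ideal.span (Set.range (X : Fin e → MvPolynomial (Fin e) k))
  minimal₃ : ∀ i j, φ₃ i j ∈ Ideal.span (Set.range (X : Fin e → MvPolynomial (Fin e) k))

/-! The explicit binomials and matrices. The variables `x_1, …, x_4` and the exponents
`α_1, …, α_4` are indexed by `0, …, 3`. -/

/-- The six binomials. -/
noncomputable def sixBinomials (k : Type*) [Field k] (α : Fin 4 → ℕ) :
    Fin 6 → MvPolynomial (Fin 4) k :=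
  ![X 0 ^ α 0 - X 1 ^ (α 1 - 1) * X 3,
    X 1 ^ α 1 - X 2 ^ (α 2 - 1) * X 0,
    X 2 ^ α 2 - X 3 ^ (α 3 - 1) * X 1,
    X 3 ^ α 3 - X 0 ^ (α 0 - 1) * X 2,
    X 0 ^ (α 0 - 1) * X 1 - X 2 ^ (α 2 - 1) * X 3,
    X 0 * X 3 ^ (α 3 - 1) - X 1 ^ (α 1 - 1) * X 2]

/-- The row of the six binomials, the last one with the opposite sign: this is the sign for which
`phi₁ * phi₂ = 0`. -/
noncomputable def phi₁ (k : Type*) [Field k] (α : Fin 4 → ℕ) :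
    Matrix (Fin 1) (Fin 6) (MvPolynomial (Fin 4) k) :=
  !![sixBinomials k α 0, sixBinomials k α 1, sixBinomials k α 2, sixBinomials k α 3,
     sixBinomials k α 4, -sixBinomials k α 5]

noncomputable def phi₂ (k : Type*) [Field k] (α : Fin 4 → ℕ) :
    Matrix (Fin 6) (Fin 8) (MvPolynomial (Fin 4) k) :=
  !![X 2 ^ (α 2 - 1), X 1, 0, 0, 0, 0, X 3 ^ (α 3 - 1), X 2;
     X 0 ^ (α 0 - 1), X 3, 0, 0, X 3 ^ (α 3 - 1), X 2, 0, 0;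
     0, 0, X 0 ^ (α 0 - 1), X 3, X 1 ^ (α 1 - 1), X 0, 0, 0;
     0, 0, X 2 ^ (α 2 - 1), X 1, 0, 0, X 1 ^ (α 1 - 1), X 0;
     -X 1 ^ (α 1 - 1), -X 0, X 3 ^ (α 3 - 1), X 2, 0, 0, 0, 0;
     0, 0, 0, 0, -X 2 ^ (α 2 - 1), -X 1, X 0 ^ (α 0 - 1), X 3]

/-- The matrix of the last map, written as the transpose of a `3 × 8` matrix. -/
noncomputable def phi₃ (k : Type*) [Field k] (α : Fin 4 → ℕ) :
    Matrix (Fin 8) (Fin 3) (MvPolynomial (Fin 4) k) :=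
  Matrix.transpose
  !![0, X 2, 0, X 0, 0, -X 3, 0, -X 1;
     X 3 ^ (α 3 - 1), 0, X 1 ^ (α 1 - 1), 0, -X 0 ^ (α 0 - 1), 0, -X 2 ^ (α 2 - 1), 0;
     -X 2, -X 3 ^ (α 3 - 1), -X 0, -X 1 ^ (α 1 - 1), X 3, X 0 ^ (α 0 - 1), X 1, X 2 ^ (α 2 - 1)]

/-! The pseudo-Frobenius numbers are `p`, `q` and `F = p + q`. Since `F = 2g - 3` is odd, exactly
one of `p`, `q` is odd. Draw an arc `i → j` when `p + n i - n j ∈ S`; almost symmetry makes the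
digraph of `q` the reversed complement of that of `p` (`FrobeniusPair.right_iff`). If `j` is the
only neighbour of `i`, then `p + n i = (α j - 1) n j` (`FrobeniusPair.single`), so `α j` has the
parity of `p`. Hence each `j` is the sole neighbour of at most one vertex in the two digraphs
together. The eight out-degrees are positive with sum 12 and at most four equal 1, so four are 1 and
four are 2. A finite check (`isClassified_ofBits`) leaves eight digraphs, up to relabelling and
exchange of `p` and `q`. Parity and the minimality of the `α i` exclude seven of them. The directed
4-cycle remains and forces `q = 2p` (`right_eq_two_mul`), so `F = 3p`, and `p` and all `α i` are
odd.

On the cycle `p + n i = (α (i+1) - 1) n (i+1)`. So, after substituting `x_i = t ^ n i`, the 2 × 4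
matrix with columns `(x_i ^ (α i - 1), x_{i-1})` has proportional rows, and the six binomials are
its maximal minors up to sign. They rewrite each monomial as a power of `x_0` times a normal
monomial (`IsCyclicWeight.exists_normal`). The weights of the normal monomials lie in the Apéry set
of `n 0` and are distinct. Counting residues mod `n 0` gives the formula for `n 0`, and rotation the
other three; distinctness of the weights also shows that the binomials generate the ideal
(`definingIdeal_eq_span`).

The resolution is the Eagon-Northcott complex of this matrix. Its homology is killed by the minors,
through explicit homotopies, and the ideal of minors contains the regular sequence `x_i ^ n 3 - x_3
^ n i`, `i = 0, 1, 2`. A complex of free modules of length three whose homology is killed by three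
such elements is exact. -/

/-! ### Combinations of four generators -/

/-- `z` is a combination of the `n i` with coefficients in `ℕ`. -/
def IsNatComb (n : Fin 4 → ℕ) (z : ℤ) : Prop :=
  ∃ c : Fin 4 → ℕ, z = ∑ i, (c i : ℤ) * n i

/-- The indices `i, j, k, l` are a reordering of `0, 1, 2, 3`. -/
def IsLabelling (i j k l : Fin 4) : Prop :=
  i ≠ j ∧ i ≠ k ∧ i ≠ l ∧ j ≠ k ∧ j ≠ l ∧ k ≠ l

instance (i j k l : Fin 4) : Decidable (IsLabelling i j k l) := by
  unfold IsLabelling; infer_instance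

theorem IsLabelling.sum_eq {i j k l : Fin 4} (h : IsLabelling i j k l) (f : Fin 4 → ℤ) :
    ∑ x, f x = f i + f j + f k + f l := by
  have hu : (Finset.univ : Finset (Fin 4)) = {i, j, k, l} := by
    revert i j k l; decide
  obtain ⟨h1, h2, h3, h4, h5, h6⟩ := h
  rw [hu, Finset.sum_insert (by simp [*]), Finset.sum_insert (by simp [*]),
    Finset.sum_insert (by simp [*]), Finset.sum_singleton]
  ring

namespace IsNatComb

variable {n : Fin 4 → ℕ}

theorem zero : IsNatComb n 0 := ⟨0, by simp⟩

theorem add {y z : ℤ} (hy : IsNatComb n y) (hz : IsNatComb n z) : IsNatComb n (y + z) := by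
  obtain ⟨c, rfl⟩ := hy
  obtain ⟨d, rfl⟩ := hz
  refine ⟨c + d, ?_⟩
  rw [← Finset.sum_add_distrib]
  refine Finset.sum_congr rfl fun i _ => ?_
  push_cast [Pi.add_apply]
  ring

theorem gen (i : Fin 4) : IsNatComb n (n i) := by
  refine ⟨fun j => if j = i then 1 else 0, ?_⟩
  simp

theorem mul {a : ℤ} (ha : 0 ≤ a) (i : Fin 4) : IsNatComb n (a * n i) := by
  lift a to ℕ using ha
  refine ⟨fun j => if j = i then a else 0, ?_⟩
  simp

theorem of_eq {i j k l : Fin 4} {a b c d z : ℤ}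
    (ha : 0 ≤ a) (hb : 0 ≤ b) (hc : 0 ≤ c) (hd : 0 ≤ d)
    (hz : z = a * n i + b * n j + c * n k + d * n l) : IsNatComb n z :=
  hz ▸ (((mul ha i).add (mul hb j)).add (mul hc k)).add (mul hd l)

theorem exists_eq {i j k l : Fin 4} (h : IsLabelling i j k l) {z : ℤ} (hz : IsNatComb n z) :
    ∃ a b c d : ℤ, 0 ≤ a ∧ 0 ≤ b ∧ 0 ≤ c ∧ 0 ≤ d ∧
      z = a * n i + b * n j + c * n k + d * n l := by
  obtain ⟨c, rfl⟩ := hz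
  exact ⟨c i, c j, c k, c l, by positivity, by positivity, by positivity, by positivity,
    h.sum_eq _⟩

end IsNatComb

/-! ### Pairs of complementary pseudo-Frobenius numbers -/

/-- `p` and `q` are complementary pseudo-Frobenius numbers of an almost symmetric numerical
semigroup of type `3` minimally generated by four odd numbers `n i`, and `α` is bounded
by the multiples of `n i` which are combinations of the other generators. -/
structure FrobeniusPair (n α : Fin 4 → ℕ) (p q : ℤ) : Prop where
  odd_gen : ∀ i, Odd (n i : ℤ)
  odd_add : Odd (p + q)
  two_le : ∀ i, 2 ≤ (α i : ℤ)
  alpha_le : ∀ i (c : ℕ) (d : Fin 4 → ℕ), 0 < c → d i = 0 → (c : ℤ) * n i = ∑ j, (d j : ℤ) * n j →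
    α i ≤ c
  alpha_eq : ∀ i, ∃ d : Fin 4 → ℕ, d i = 0 ∧ (α i : ℤ) * n i = ∑ j, (d j : ℤ) * n j
  left_notMem : ¬ IsNatComb n p
  right_notMem : ¬ IsNatComb n q
  add_notMem : ¬ IsNatComb n (p + q)
  left_add : ∀ i, IsNatComb n (p + n i)
  right_add : ∀ i, IsNatComb n (q + n i)
  dual : ∀ i j, i ≠ j → ¬ IsNatComb n (p + n i - n j) → IsNatComb n (q + n j - n i)

namespace FrobeniusPair

variable {n α : Fin 4 → ℕ} {p q : ℤ} {i j k l : Fin 4}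

theorem symm (h : FrobeniusPair n α p q) : FrobeniusPair n α q p where
  odd_gen := h.odd_gen
  odd_add := by rw [add_comm]; exact h.odd_add
  two_le := h.two_le
  alpha_le := h.alpha_le
  alpha_eq := h.alpha_eq
  left_notMem := h.right_notMem
  right_notMem := h.left_notMem
  add_notMem := by rw [add_comm]; exact h.add_notMem
  left_add := h.right_add
  right_add := h.left_add
  dual i j hij hn := by
    by_contra hc
    exact hn (h.dual j i hij.symm hc)

theorem comp (h : FrobeniusPair n α p q) (σ : Equiv.Perm (Fin 4)) :
    FrobeniusPair (n ∘ σ) (α ∘ σ) p q := by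
  have key : ∀ z, IsNatComb (n ∘ σ) z ↔ IsNatComb n z := by
    intro z
    constructor
    · rintro ⟨c, rfl⟩
      exact ⟨c ∘ σ.symm,
        by simpa using Equiv.sum_comp σ (fun x => ((c ∘ σ.symm) x : ℤ) * n x)⟩
    · rintro ⟨c, rfl⟩
      refine ⟨c ∘ σ, ?_⟩
      rw [← Equiv.sum_comp σ]
      simp
  constructor
  · exact fun i => h.odd_gen _
  · exact h.odd_add
  · exact fun i => h.two_le _
  · intro i c d hc hd hs
    refine h.alpha_le (σ i) c (d ∘ σ.symm) hc (by simpa using hd) ?_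
    rw [← Equiv.sum_comp σ]
    simpa using hs
  · intro i
    obtain ⟨d, hd, he⟩ := h.alpha_eq (σ i)
    refine ⟨d ∘ σ, hd, ?_⟩
    rw [← Equiv.sum_comp σ] at he
    exact he
  · rw [key]; exact h.left_notMem
  · rw [key]; exact h.right_notMem
  · rw [key]; exact h.add_notMem
  · intro i; rw [key]; exact h.left_add _
  · intro i; rw [key]; exact h.right_add _
  · intro i j hij
    rw [key, key]
    exact h.dual _ _ (σ.injective.ne hij)

theorem pos (h : FrobeniusPair n α p q) (i : Fin 4) : 0 < (n i : ℤ) := by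
  have := h.odd_gen i
  by_contra hc
  have h0 : (n i : ℤ) = 0 := by omega
  rw [h0] at this
  exact absurd this (by decide)

theorem le_of_eq (h : FrobeniusPair n α p q) (hl : IsLabelling i j k l) {a b c d : ℤ}
    (ha : 0 < a) (hb : 0 ≤ b) (hc : 0 ≤ c) (hd : 0 ≤ d)
    (he : a * n i = b * n j + c * n k + d * n l) : (α i : ℤ) ≤ a := by
  lift a to ℕ using ha.le
  lift b to ℕ using hb
  lift c to ℕ using hc
  lift d to ℕ using hd
  have := h.alpha_le i a
    (fun x => if x = j then b else if x = k then c else if x = l then d else 0)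
    (by exact_mod_cast ha) ?_ ?_
  · exact_mod_cast this
  · obtain ⟨h1, h2, h3, h4, h5, h6⟩ := hl
    simp [*]
  · rw [hl.sum_eq]
    obtain ⟨h1, h2, h3, h4, h5, h6⟩ := hl
    simp only [h1, h2, h3, h4.symm, h5.symm, h6.symm, if_true, if_false]
    push_cast
    linarith

/-- The two digraphs `i ↦ j` given by `p + n i - n j ∈ S` and `q + n i - n j ∈ S` are disjoint up
to reversal. -/
theorem not_right (h : FrobeniusPair n α p q) (hp : IsNatComb n (p + n i - n j)) :
    ¬ IsNatComb n (q + n j - n i) := fun hq =>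
  h.add_notMem (by have := hp.add hq; ring_nf at this ⊢; exact this)

theorem right_iff (h : FrobeniusPair n α p q) (hij : i ≠ j) :
    IsNatComb n (q + n j - n i) ↔ ¬ IsNatComb n (p + n i - n j) :=
  ⟨fun hq hp => h.not_right hp hq, h.dual i j hij⟩

/-- A vertex has an expression in terms of the other generators. -/
theorem exists_row (h : FrobeniusPair n α p q) (hl : IsLabelling i j k l) :
    ∃ a b c : ℤ, 0 ≤ a ∧ 0 ≤ b ∧ 0 ≤ c ∧ p + n i = a * n j + b * n k + c * n l := by
  obtain ⟨a, b, c, d, ha, hb, hc, hd, he⟩ := (h.left_add i).exists_eq hl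
  have ha0 : a = 0 := by
    by_contra hne
    exact h.left_notMem (IsNatComb.of_eq (i := i) (j := j) (k := k) (l := l)
      (a := a - 1) (by omega) hb hc hd (by linarith))
  exact ⟨b, c, d, hb, hc, hd, by rw [he, ha0]; ring⟩

/-- A coefficient of a nonneighbour in an expression vanishes. -/
theorem coeff_eq_zero (_ : FrobeniusPair n α p q) (hj : ¬ IsNatComb n (p + n i - n j))
    {i' k l : Fin 4} {a b c d : ℤ} (ha : 0 ≤ a) (hb : 0 ≤ b) (hc : 0 ≤ c) (hd : 0 ≤ d)
    (he : p + n i = a * n j + b * n k + c * n l + d * n i') : a = 0 := by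
  by_contra hne
  exact hj (IsNatComb.of_eq (i := j) (j := k) (k := l) (l := i')
    (a := a - 1) (by omega) hb hc hd (by linarith))

theorem exists_double (h : FrobeniusPair n α p q) (hl : IsLabelling i j k l)
    (hn : ¬ IsNatComb n (p + n i - n l)) :
    ∃ a b : ℤ, 0 ≤ a ∧ 0 ≤ b ∧ p + n i = a * n j + b * n k := by
  obtain ⟨a, b, c, ha, hb, hc, he⟩ := h.exists_row hl
  have := h.coeff_eq_zero (i := i) (j := l) (i' := l) (k := j) (l := k) hn hc ha hb le_rfl
    (by linarith)
  subst this
  exact ⟨a, b, ha, hb, by linarith⟩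

/-- Starting from an expression of `p + n i - n j`, rather than of `p + n i`, guarantees that `n j`
occurs. -/
theorem exists_double_pos (h : FrobeniusPair n α p q) (hl : IsLabelling i j k l)
    (hn : ¬ IsNatComb n (p + n i - n l)) (hj : IsNatComb n (p + n i - n j)) :
    ∃ a b : ℤ, 1 ≤ a ∧ 0 ≤ b ∧ p + n i = a * n j + b * n k := by
  obtain ⟨a, b, c, d, ha, hb, hc, hd, he⟩ := hj.exists_eq hl
  have ha0 : a = 0 := by
    by_contra hne
    exact h.left_notMem (IsNatComb.of_eq (i := i) (j := j) (k := k) (l := l)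
      (a := a - 1) (b := b + 1) (by omega) (by omega) hc hd (by linarith))
  subst ha0
  have := h.coeff_eq_zero (i := i) (j := l) (i' := l) (k := j) (l := k) (a := d) (b := b + 1)
    (c := c) hn hd (by omega) hc le_rfl (by linarith)
  subst this
  exact ⟨b + 1, c, by omega, hc, by linarith⟩

/-- Such a relation would give `α i ≤ 1`. -/
theorem two_le_of_eq (h : FrobeniusPair n α p q) (hl : IsLabelling i j k l) {b c d : ℤ}
    (hb : 0 ≤ b) (hc : 0 ≤ c) (hd : 0 ≤ d) (he : (n i : ℤ) = b * n j + c * n k + d * n l) :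
    False := by
  have h1 := h.le_of_eq hl one_pos hb hc hd (by linarith)
  have h2 := h.two_le i
  omega

theorem exists_alpha_eq (h : FrobeniusPair n α p q) (hl : IsLabelling i j k l) :
    ∃ a b c : ℤ, 0 ≤ a ∧ 0 ≤ b ∧ 0 ≤ c ∧ α i * n i = a * n j + b * n k + c * n l := by
  obtain ⟨d, hd, he⟩ := h.alpha_eq i
  rw [hl.sum_eq, hd] at he
  exact ⟨d j, d k, d l, by positivity, by positivity, by positivity, by rw [he]; push_cast; ring⟩

/-- If `j` is the only neighbour of `i`, then `p + n i = (α j - 1) n j`. -/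
theorem single (h : FrobeniusPair n α p q) (hl : IsLabelling i j k l)
    (hk : ¬ IsNatComb n (p + n i - n k)) (hl' : ¬ IsNatComb n (p + n i - n l)) :
    p + n i = (α j - 1 : ℤ) * n j := by
  obtain ⟨a, b, ha, hb, he⟩ := h.exists_double hl hl'
  have hb0 := h.coeff_eq_zero (i := i) (j := k) (i' := l) (k := j) (l := l) (c := 0) (d := 0)
    hk hb ha le_rfl le_rfl (by linarith)
  subst hb0
  obtain ⟨h1, h2, h3, h4, h5, h6⟩ := hl
  -- Adding `n j` to `p + n i = a n j` and inserting an expression of `p + n j` gives `(a + 1) n j =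
  -- (b' + 1) n i + c' n k + d' n l`.
  have hle : (α j : ℤ) ≤ a + 1 := by
    obtain ⟨b', c', d', hb', hc', hd', he'⟩ :=
      h.exists_row (i := j) (j := i) (k := k) (l := l) ⟨h1.symm, h4, h5, h2, h3, h6⟩
    exact h.le_of_eq (i := j) (j := i) (k := k) (l := l) ⟨h1.symm, h4, h5, h2, h3, h6⟩
      (b := b' + 1) (by omega) (by omega) hc' hd' (by linarith)
  -- Otherwise replace `α j n j` by a combination of the others: `n k` and `n l` cannot occur, so `n
  -- i` does, and cancelling it puts `p` into `S`.
  have hlt : a < α j := by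
    by_contra hge
    push Not at hge
    obtain ⟨x, y, z, hx, hy, hz, hxyz⟩ := h.exists_alpha_eq (i := j) (j := i) (k := k) (l := l)
      ⟨h1.symm, h4, h5, h2, h3, h6⟩
    have hy0 := h.coeff_eq_zero (i := i) (j := k) (i' := l) (k := j) (l := i) (b := a - α j)
      hk hy (by omega) hx hz (by linarith)
    have hz0 := h.coeff_eq_zero (i := i) (j := l) (i' := k) (k := j) (l := i) (b := a - α j)
      hl' hz (by omega) hx hy (by linarith)
    subst hy0 hz0
    have hpos := h.pos j
    have h2 := h.two_le j
    have hx0 : x ≠ 0 := by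
      rintro rfl
      have : 0 < (α j : ℤ) * n j := by positivity
      omega
    exact h.left_notMem (IsNatComb.of_eq (i := i) (j := j) (k := k) (l := l)
      (a := x - 1) (b := a - α j) (c := 0) (d := 0) (by omega) (by omega) le_rfl le_rfl
      (by linarith))
  have : a = α j - 1 := by omega
  rw [he, this]
  ring

/-- All generators are odd, so `p + 1 ≡ a + b` modulo 2. -/
theorem odd_iff_of_eq (h : FrobeniusPair n α p q) {a b : ℤ}
    (he : p + n i = a * n j + b * n k) : Odd p ↔ Even (a + b) := by
  have hi := h.odd_gen i
  have hj := h.odd_gen j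
  have hk := h.odd_gen k
  have := congrArg Odd he
  simp only [Int.odd_add, Int.odd_mul, ← Int.not_odd_iff_even, hi, hj, hk] at this ⊢
  tauto

theorem odd_alpha_iff (h : FrobeniusPair n α p q) (he : p + n i = (α j - 1 : ℤ) * n j) :
    Odd p ↔ Odd (α j : ℤ) := by
  rw [h.odd_iff_of_eq (i := i) (j := j) (k := j) (a := α j - 1) (b := 0) (by linarith), add_zero,
    Int.even_sub_one, Int.not_even_iff_odd]

theorem odd_right_iff (h : FrobeniusPair n α p q) : Odd q ↔ ¬ Odd p := by
  have := h.odd_add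
  rw [Int.odd_add, ← Int.not_odd_iff_even] at this
  tauto

/-- A relation all whose coefficients are even contradicts the minimality of `α i`. -/
theorem not_even (h : FrobeniusPair n α p q) (hl : IsLabelling i j k l) {b c d : ℤ}
    (hb : 0 ≤ b) (hc : 0 ≤ c) (hd : 0 ≤ d) (he : α i * n i = b * n j + c * n k + d * n l)
    (ha2 : ¬ Odd (α i : ℤ)) (hb2 : ¬ Odd b) (hc2 : ¬ Odd c) (hd2 : ¬ Odd d) : False := by
  rw [Int.not_odd_iff_even] at ha2 hb2 hc2 hd2
  obtain ⟨a', ha'⟩ := ha2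
  obtain ⟨b', rfl⟩ := hb2
  obtain ⟨c', rfl⟩ := hc2
  obtain ⟨d', rfl⟩ := hd2
  have h2 := h.two_le i
  have := h.le_of_eq (a := a') hl (by omega) (b := b') (c := c') (d := d') (by omega) (by omega)
    (by omega) (by rw [ha'] at he; linarith)
  omega

end FrobeniusPair

/-! ### The digraph of a pseudo-Frobenius number -/

/-- The digraph `i ↦ j` given by `p + n i - n j ∈ S` is the one with adjacency matrix `T`. -/
def HasArcs (n : Fin 4 → ℕ) (p : ℤ) (T : Fin 4 → Fin 4 → Bool) : Prop :=
  ∀ i j, i ≠ j → (IsNatComb n (p + n i - n j) ↔ T i j = true)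

namespace HasArcs

variable {n α : Fin 4 → ℕ} {p q : ℤ} {T : Fin 4 → Fin 4 → Bool} {i j k l : Fin 4}

theorem no (hT : HasArcs n p T) (hij : i ≠ j) (h : T i j = false) :
    ¬ IsNatComb n (p + n i - n j) := by
  rw [hT i j hij, h]; decide

theorem yes (hT : HasArcs n p T) (hij : i ≠ j) (h : T i j = true) :
    IsNatComb n (p + n i - n j) := (hT i j hij).2 h

theorem reverse (hT : HasArcs n p T) (h : FrobeniusPair n α p q) :
    HasArcs n q (fun i j => !T j i) := by
  intro i j hij
  rw [h.right_iff hij.symm, hT j i hij.symm]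
  simp

theorem comp (hT : HasArcs n p T) (σ : Equiv.Perm (Fin 4)) :
    HasArcs (n ∘ σ) p (fun i j => T (σ i) (σ j)) := by
  intro i j hij
  rw [← hT _ _ (σ.injective.ne hij)]
  constructor
  · rintro ⟨c, hc⟩
    exact ⟨c ∘ σ.symm, hc.trans
      (by simpa using Equiv.sum_comp σ (fun x => ((c ∘ σ.symm) x : ℤ) * n x))⟩
  · rintro ⟨c, hc⟩
    refine ⟨c ∘ σ, hc.trans ?_⟩
    rw [← Equiv.sum_comp σ]
    rfl

theorem single (hT : HasArcs n p T) (h : FrobeniusPair n α p q) (hl : IsLabelling i j k l)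
    (hk : T i k = false) (hl' : T i l = false) : p + n i = (α j - 1 : ℤ) * n j :=
  h.single hl (hT.no hl.2.1 hk) (hT.no hl.2.2.1 hl')

theorem double (hT : HasArcs n p T) (h : FrobeniusPair n α p q) (hl : IsLabelling i j k l)
    (hl' : T i l = false) :
    ∃ a b : ℤ, 0 ≤ a ∧ 0 ≤ b ∧ p + n i = a * n j + b * n k :=
  h.exists_double hl (hT.no hl.2.2.1 hl')

theorem double_pos (hT : HasArcs n p T) (h : FrobeniusPair n α p q) (hl : IsLabelling i j k l)
    (hl' : T i l = false) (hj : T i j = true) :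
    ∃ a b : ℤ, 1 ≤ a ∧ 0 ≤ b ∧ p + n i = a * n j + b * n k :=
  h.exists_double_pos hl (hT.no hl.2.2.1 hl') (hT.yes hl.1 hj)

end HasArcs

/-! ### Contradictions from parity and minimality of the `α i` -/

namespace FrobeniusPair

variable {n α : Fin 4 → ℕ} {p q : ℤ} {i j k l : Fin 4}

/-- If `a ≥ α j`, replacing `α j n j` by `u n r + v n s` would make `r` a neighbour of `i`. -/
theorem coeff_lt (_ : FrobeniusPair n α p q) {r s : Fin 4} {a b u v : ℤ}
    (hr : ¬ IsNatComb n (p + n i - n r)) (hb : 0 ≤ b) (hu : 1 ≤ u) (hv : 0 ≤ v)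
    (he : p + n i = a * n j + b * n k) (hα : α j * n j = u * n r + v * n s) : a < α j := by
  by_contra hge
  push Not at hge
  exact hr (IsNatComb.of_eq (i := j) (j := k) (k := r) (l := s) (a := a - α j) (b := b)
    (c := u - 1) (d := v) (by omega) hb (by omega) hv (by linarith))

/-- Two unique neighbours of different vertices are different. -/
theorem single_injective (h : FrobeniusPair n α p q) (hl : IsLabelling i j k l) {x : Fin 4}
    (h1 : p + n i = (α x - 1 : ℤ) * n x) (h2 : p + n j = (α x - 1 : ℤ) * n x) : False :=
  h.two_le_of_eq hl (b := 1) (c := 0) (d := 0) zero_le_one le_rfl le_rfl (by linarith)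

/-- The combination `h4 - h3 + h2 - h1` eliminates `p`, `q` and `n i`, leaving a relation among `n
j`, `n k`, `n l`. Its coefficients are too small for the minimality of the `α`s, so all of them
vanish. -/
theorem eliminate (h : FrobeniusPair n α p q) (hl : IsLabelling i j k l) {c d c' d' : ℤ}
    (h1 : p + n i = (α j - 1 : ℤ) * n j) (h2 : p + n k = c * n l + d * n j)
    (h3 : q + n j = (α l - 1 : ℤ) * n l) (h4 : q + n i = c' * n l + d' * n k)
    (hc : 0 ≤ c) (hd : 0 ≤ d) (hd' : 1 ≤ d') (hdk : d' ≤ α k) :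
    d = α j - 2 ∧ d' = 1 ∧ c + c' = α l - 1 := by
  obtain ⟨hij, hik, hil, hjk, hjl, hkl⟩ := hl
  have hdj : d ≤ α j - 2 := by
    by_contra hlt
    exact h.two_le_of_eq (i := k) (j := i) (k := l) (l := j)
      ⟨hik.symm, hkl, hjk.symm, hil, hij, hjl.symm⟩ (b := 1) (c := c) (d := d - (α j - 1))
      zero_le_one hc (by omega) (by linarith)
  have key : (α l - 1 - c' - c) * n l + (α j - 2 - d) * n j = (d' - 1) * n k := by
    linear_combination h4 - h3 + h2 - h1
  rcases lt_or_ge (α l - 1 - c' - c : ℤ) 0 with hneg | hpos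
  · have hpl := h.pos l
    have hpj := h.pos j
    have : 0 < (α j - 2 - d : ℤ) := by
      have : 0 < (α j - 2 - d : ℤ) * n j := by
        have h5 := mul_pos (neg_pos.2 hneg) hpl
        have h6 := mul_nonneg (sub_nonneg.2 hd') (h.pos k).le
        linarith
      exact pos_of_mul_pos_left this hpj.le
    have := h.le_of_eq (i := j) (j := l) (k := k) (l := i)
      ⟨hjl, hjk, hij.symm, hkl.symm, hil.symm, hik.symm⟩ this (b := -(α l - 1 - c' - c))
      (c := d' - 1) (d := 0) (by omega) (by omega) le_rfl (by linarith)
    omega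
  · have hd1 : d' = 1 := by
      by_contra hne
      have := h.le_of_eq (i := k) (j := l) (k := j) (l := i) (a := d' - 1)
        ⟨hkl, hjk.symm, hik.symm, hjl.symm, hil.symm, hij.symm⟩ (by omega)
        (b := α l - 1 - c' - c) (c := α j - 2 - d) (d := 0) hpos (by omega) le_rfl (by linarith)
      omega
    rw [hd1] at key
    have hpl := h.pos l
    have hpj := h.pos j
    have h5 := mul_nonneg hpos hpl.le
    have h6 := mul_nonneg (by omega : (0 : ℤ) ≤ α j - 2 - d) hpj.le
    have h7 : (α l - 1 - c' - c) * (n l : ℤ) = 0 := by linarith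
    have h8 : (α j - 2 - d) * (n j : ℤ) = 0 := by linarith
    have h9 := (mul_eq_zero.1 h7).resolve_right hpl.ne'
    have h10 := (mul_eq_zero.1 h8).resolve_right hpj.ne'
    omega

/-- Here `d = α j - 2` and `α k` are even and `c` is odd, so `α k n k = (c + 1) n l + d n j` has
only even coefficients and can be halved. -/
theorem false_of_even (h : FrobeniusPair n α p q) (hl : IsLabelling i j k l) {c d c' d' : ℤ}
    (hp : ¬ Odd p)
    (h1 : p + n i = (α j - 1 : ℤ) * n j) (h2 : p + n k = c * n l + d * n j)
    (h3 : q + n j = (α l - 1 : ℤ) * n l) (h4 : q + n i = c' * n l + d' * n k)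
    (h5 : p + n l = (α k - 1 : ℤ) * n k)
    (hc : 0 ≤ c) (hd : 0 ≤ d) (hd' : 1 ≤ d') (hdk : d' ≤ α k) : False := by
  obtain ⟨h6, -, -⟩ := h.eliminate hl h1 h2 h3 h4 hc hd hd' hdk
  have hj := (h.odd_alpha_iff h1).not.1 hp
  have hk := (h.odd_alpha_iff h5).not.1 hp
  have hcd := (h.odd_iff_of_eq h2).not.1 hp
  obtain ⟨hij, hik, hil, hjk, hjl, hkl⟩ := hl
  refine h.not_even (i := k) (j := l) (k := j) (l := i)
        ⟨hkl, hjk.symm, hik.symm, hjl.symm, hil.symm, hij.symm⟩ (b := c + 1) (c := d) (d := 0)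
        (by omega) hd le_rfl (by linarith) hk ?_ ?_ (by decide)
  all_goals
    rw [Int.not_odd_iff_even] at *
    rw [Int.not_even_iff_odd] at hcd
    subst h6
    rw [Int.even_iff] at *
    rw [Int.odd_iff] at hcd
    omega

/-- Two generators whose first multiples in the span of the others agree. -/
theorem false_of_alpha_mul_eq (h : FrobeniusPair n α p q) (hl : IsLabelling i j k l) {a b : ℤ}
    (hij : (α i : ℤ) * n i = α j * n j) (hi : Odd (α i : ℤ)) (hj : Odd (α j : ℤ))
    (hk : ¬ Odd (α k : ℤ)) (ha : 0 ≤ a) (hb : 0 ≤ b) (he : α k * n k = a * n i + b * n j) :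
    False := by
  have hab : Odd a ↔ Odd b := by
    have hn1 := h.odd_gen i
    have hn2 := h.odd_gen j
    have hn3 := h.odd_gen k
    have := congrArg Odd he
    simp only [Int.odd_add, Int.odd_mul, ← Int.not_odd_iff_even, hn1, hn2] at this hk
    tauto
  obtain ⟨g1, g2, g3, g4, g5, g6⟩ := hl
  have hlk : IsLabelling k i j l := ⟨g2.symm, g4.symm, g6, g1, g3, g5⟩
  by_cases hao : Odd a
  · have hbo := hab.1 hao
    have hi' := h.two_le i
    have hj' := h.two_le j
    have hk' := h.two_le k
    -- Trading `α i n i` for `α j n j` changes both parities, and the relation could again be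
    -- halved.
    have h1 : a < α i := by
      by_contra hge
      refine h.not_even hlk (b := a - α i) (c := b + α j) (d := 0) (by omega) (by omega) le_rfl
        (by linarith) hk ?_ ?_ (by decide)
      all_goals rw [Int.odd_iff] at *; omega
    have h2 : b < α j := by
      by_contra hge
      refine h.not_even hlk (b := a + α i) (c := b - α j) (d := 0) (by omega) (by omega) le_rfl
        (by linarith) hk ?_ ?_ (by decide)
      all_goals rw [Int.odd_iff] at *; omega
    rw [Int.not_odd_iff_even] at hk
    obtain ⟨k', hk''⟩ := hk
    obtain ⟨x, hx⟩ := hao.add_odd hi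
    obtain ⟨y, hy⟩ := hj.sub_odd hbo
    -- Half of `(a + α i) n i = α k n k + (α j - b) n j`, where `x = (a + α i) / 2 < α i`.
    have e : x * n i = k' * n k + y * (n j : ℤ) := by
      have : (α k : ℤ) * n k + (α j - b) * n j = (a + α i) * n i := by linarith
      rw [hk'', hx, hy] at this
      linarith
    have := h.le_of_eq (i := i) (j := k) (k := j) (l := l) ⟨g2, g1, g3, g4.symm, g6, g5⟩
      (a := x) (b := k') (c := y) (d := 0) (by omega) (by omega) (by omega) le_rfl (by linarith)
    omega
  · have hbo := hab.not.1 hao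
    exact h.not_even hlk ha hb le_rfl (d := 0) (by linarith) hk hao hbo (by decide)

/-- The sum of the two relations is `α i n i = α j n j`; for even `p` both sides could be halved. -/
theorem odd_of_two_cycle (h : FrobeniusPair n α p q) (hl : IsLabelling i j k l)
    (h1 : p + n i = (α j - 1 : ℤ) * n j) (h2 : p + n j = (α i - 1 : ℤ) * n i) : Odd p := by
  by_contra hp
  exact h.not_even hl (b := α j) (c := 0) (d := 0) (by omega) le_rfl le_rfl (by linarith)
    ((h.odd_alpha_iff h2).not.1 hp) ((h.odd_alpha_iff h1).not.1 hp) (by decide) (by decide)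

/-- No generator is a combination of the others, so `c' < c` and `0 < d' - d < α j`. Combining `he`
with `h1` and `h3` then writes `(α l - 2) n l` in terms of `n i` and `n j`, against the minimality
of `α l ≥ 3`. -/
theorem false_of_two_cycles_aux (h : FrobeniusPair n α p q) (hl : IsLabelling i j k l)
    (h1 : p + n i = (α j - 1 : ℤ) * n j) (h2 : p + n j = (α i - 1 : ℤ) * n i)
    (h3 : p + n k = (α l - 1 : ℤ) * n l) (hk : Odd (α l : ℤ))
    {c d c' d' : ℤ} (hcc : c' ≤ c) (hc : c < α i) (hc' : 0 ≤ c')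
    (he : n l + c * n i + d * n j = n k + c' * n i + d' * n j) : False := by
  obtain ⟨g1, g2, g3, g4, g5, g6⟩ := hl
  have hdd : d < d' := by
    by_contra hge
    exact h.two_le_of_eq (i := k) (j := l) (k := i) (l := j)
      ⟨g6, g2.symm, g4.symm, g3.symm, g5.symm, g1⟩ (b := 1) (c := c - c') (d := d - d')
      zero_le_one (by omega) (by omega) (by linarith)
  have hC : c' < c := by
    by_contra hge
    exact h.two_le_of_eq (i := l) (j := k) (k := i) (l := j)
      ⟨g6.symm, g3.symm, g5.symm, g2.symm, g4.symm, g1⟩ (b := 1) (c := c' - c) (d := d' - d)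
      zero_le_one (by omega) (by omega) (by linarith)
  have hD : d' - d < α j := by
    by_contra hge
    exact h.two_le_of_eq (i := l) (j := k) (k := i) (l := j)
      ⟨g6.symm, g3.symm, g5.symm, g2.symm, g4.symm, g1⟩ (b := 1) (c := α i - (c - c'))
      (d := d' - d - α j)
      zero_le_one (by omega) (by omega) (by linarith)
  have hk2 : (α l : ℤ) - 2 > 0 := by
    have := h.two_le l
    rcases this.lt_or_eq with h5 | h5
    · omega
    · rw [← h5] at hk; exact absurd hk (by decide)
  have := h.le_of_eq (i := l) (j := j) (k := i) (l := k)
    ⟨g5.symm, g3.symm, g6.symm, g1.symm, g4, g2⟩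
    hk2 (b := α j - 1 - (d' - d)) (c := c - c' - 1) (d := 0) (by omega) (by omega) le_rfl
    (by linear_combination h1 - h3 - he)
  omega

/-- Subtracting `h5` and `h6` eliminates `q`. As `α i n i = α j n j`, the coefficients of `n i` may
be reduced modulo `α i`; exchanging `k` and `l` orders them. -/
theorem false_of_two_cycles (h : FrobeniusPair n α p q) (hl : IsLabelling i j k l)
    (h1 : p + n i = (α j - 1 : ℤ) * n j) (h2 : p + n j = (α i - 1 : ℤ) * n i)
    (h3 : p + n k = (α l - 1 : ℤ) * n l) (h4 : p + n l = (α k - 1 : ℤ) * n k)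
    {c d c' d' : ℤ}
    (h5 : q + n k = c * n i + d * n j) (h6 : q + n l = c' * n i + d' * n j) : False := by
  have hp := h.odd_of_two_cycle hl h1 h2
  have hk := (h.odd_alpha_iff h4).1 hp
  have hl' := (h.odd_alpha_iff h3).1 hp
  have hi := h.two_le i
  have hij : (α i : ℤ) * n i = α j * n j := by linarith
  have e1 : c % α i * (n i : ℤ) + (c / α i * α j + d) * n j = c * n i + d * n j := by
    have := Int.emod_add_mul_ediv c (α i)
    linear_combination -(c / α i) * hij + n i * this
  have e2 : c' % α i * (n i : ℤ) + (c' / α i * α j + d') * n j = c' * n i + d' * n j := by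
    have := Int.emod_add_mul_ediv c' (α i)
    linear_combination -(c' / α i) * hij + n i * this
  have m1 := Int.emod_nonneg c (by omega : (α i : ℤ) ≠ 0)
  have m2 := Int.emod_nonneg c' (by omega : (α i : ℤ) ≠ 0)
  have m3 := Int.emod_lt_of_pos c (by omega : 0 < (α i : ℤ))
  have m4 := Int.emod_lt_of_pos c' (by omega : 0 < (α i : ℤ))
  rcases le_total (c' % α i) (c % α i) with hle | hle
  · exact h.false_of_two_cycles_aux hl h1 h2 h3 hl' hle m3 m2
      (d := c / α i * α j + d) (d' := c' / α i * α j + d') (by linarith)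
  · obtain ⟨g1, g2, g3, g4, g5, g6⟩ := hl
    exact h.false_of_two_cycles_aux (k := l) (l := k) ⟨g1, g3, g2, g5, g4, g6.symm⟩ h1 h2 h4 hk
      hle m4 m1 (d := c' / α i * α j + d') (d' := c / α i * α j + d) (by linarith)

end FrobeniusPair

/-- The digraph on `Fin 4` with the given list of arcs. -/
def arcs (L : List (Fin 4 × Fin 4)) : Fin 4 → Fin 4 → Bool := fun i j => L.contains (i, j)

/-! ### Exclusion of seven digraphs -/

namespace FrobeniusPair

variable {n α : Fin 4 → ℕ} {p q : ℤ}

theorem false_of_arcs_two_cycles (h : FrobeniusPair n α p q)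
    (hT : HasArcs n p (arcs [(0, 3), (1, 2), (2, 1), (3, 0)])) : False := by
  have hU := hT.reverse h
  have p0 := hT.single h (i := 0) (j := 3) (k := 1) (l := 2) (by decide) rfl rfl
  have p3 := hT.single h (i := 3) (j := 0) (k := 1) (l := 2) (by decide) rfl rfl
  have p1 := hT.single h (i := 1) (j := 2) (k := 0) (l := 3) (by decide) rfl rfl
  have p2 := hT.single h (i := 2) (j := 1) (k := 0) (l := 3) (by decide) rfl rfl
  obtain ⟨c, d, -, -, q1⟩ :=
    hU.double h.symm (i := 1) (j := 0) (k := 3) (l := 2) (by decide) rfl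
  obtain ⟨c', d', -, -, q2⟩ :=
    hU.double h.symm (i := 2) (j := 0) (k := 3) (l := 1) (by decide) rfl
  exact h.false_of_two_cycles (i := 0) (j := 3) (k := 1) (l := 2) (by decide) p0 p3 p1 p2 q1 q2

theorem false_of_arcs_two_cycle (h : FrobeniusPair n α p q)
    (hT : HasArcs n p (arcs [(0, 3), (1, 2), (2, 1), (3, 0), (3, 2)])) : False := by
  have hU := hT.reverse h
  have p1 := hT.single h (i := 1) (j := 2) (k := 0) (l := 3) (by decide) rfl rfl
  have p2 := hT.single h (i := 2) (j := 1) (k := 0) (l := 3) (by decide) rfl rfl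
  have q2 := hU.single h.symm (i := 2) (j := 0) (k := 1) (l := 3) (by decide) rfl rfl
  obtain ⟨a, b, ha, hb, q0⟩ :=
    hU.double h.symm (i := 0) (j := 1) (k := 2) (l := 3) (by decide) rfl
  have hp := h.odd_of_two_cycle (i := 1) (j := 2) (k := 0) (l := 3) (by decide) p1 p2
  refine h.false_of_alpha_mul_eq (i := 1) (j := 2) (k := 0) (l := 3) (by decide) (by linarith)
    ((h.odd_alpha_iff p2).1 hp) ((h.odd_alpha_iff p1).1 hp) (fun h0 => ?_) ha
    (b := b + 1) (by omega) (by linarith)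
  exact h.odd_right_iff.1 ((h.symm.odd_alpha_iff q2).2 h0) hp

theorem false_of_arcs_path_even (h : FrobeniusPair n α p q)
    (hT : HasArcs n p (arcs [(0, 3), (1, 2), (2, 1), (2, 3), (3, 0), (3, 2)]))
    (hp : ¬ Odd p) : False := by
  have hU := hT.reverse h
  have p0 := hT.single h (i := 0) (j := 3) (k := 1) (l := 2) (by decide) rfl rfl
  have p1 := hT.single h (i := 1) (j := 2) (k := 0) (l := 3) (by decide) rfl rfl
  have q2 := hU.single h.symm (i := 2) (j := 0) (k := 1) (l := 3) (by decide) rfl rfl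
  obtain ⟨d, c, hd, hc, p3⟩ :=
    hT.double_pos h (i := 3) (j := 2) (k := 0) (l := 1) (by decide) rfl rfl
  obtain ⟨d', c', hd', hc', q1⟩ :=
    hU.double_pos h.symm (i := 1) (j := 3) (k := 0) (l := 2) (by decide) rfl rfl
  have hlt := h.symm.coeff_lt (r := 2) (s := 0) (u := d) (v := c + 1)
    (hU.no (i := 1) (by decide) rfl) hc' hd (by omega) q1 (by linarith)
  exact h.false_of_even (i := 1) (j := 2) (k := 3) (l := 0) (by decide) hp p1
    (c := c) (d := d) (c' := c') (d' := d') (by linarith) q2 (by linarith) p0 hc (by omega) hd'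
    hlt.le

theorem false_of_arcs_path (h : FrobeniusPair n α p q)
    (hT : HasArcs n p (arcs [(0, 3), (1, 2), (2, 1), (2, 3), (3, 0), (3, 2)])) : False := by
  by_cases hp : Odd p
  -- The digraph is the two-way path `0, 3, 2, 1`, which is self-complementary; `σ` carries it to
  -- the digraph of `q`, which is even here.
  · let σ : Equiv.Perm (Fin 4) := ⟨![2, 3, 1, 0], ![3, 2, 0, 1], by decide, by decide⟩
    refine (h.symm.comp σ).false_of_arcs_path_even ?_
      (fun hq => h.odd_right_iff.1 hq hp)
    intro i j hij
    rw [((hT.reverse h).comp σ) i j hij]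
    revert i j
    decide
  · exact h.false_of_arcs_path_even hT hp

theorem false_of_arcs_four (h : FrobeniusPair n α p q)
    (hT : HasArcs n p (arcs [(0, 3), (1, 2), (2, 1), (2, 3), (3, 0), (3, 1)])) : False := by
  have hU := hT.reverse h
  have p0 := hT.single h (i := 0) (j := 3) (k := 1) (l := 2) (by decide) rfl rfl
  have p1 := hT.single h (i := 1) (j := 2) (k := 0) (l := 3) (by decide) rfl rfl
  have q1 := hU.single h.symm (i := 1) (j := 0) (k := 2) (l := 3) (by decide) rfl rfl
  have q3 := hU.single h.symm (i := 3) (j := 1) (k := 0) (l := 2) (by decide) rfl rfl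
  obtain ⟨d, c, hd, hc, p2⟩ :=
    hT.double_pos h (i := 2) (j := 3) (k := 1) (l := 0) (by decide) rfl rfl
  obtain ⟨d', c', hd', hc', q0⟩ :=
    hU.double_pos h.symm (i := 0) (j := 2) (k := 1) (l := 3) (by decide) rfl rfl
  have hlt := h.symm.coeff_lt (r := 3) (s := 1) (u := d) (v := c + 1)
    (hU.no (i := 0) (by decide) rfl) hc' hd (by omega) q0 (by linarith)
  by_cases hp : Odd p
  · obtain ⟨e1, e2, e3⟩ := h.eliminate (i := 0) (j := 3) (k := 2) (l := 1) (by decide) p0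
      (c := c) (d := d) (c' := c') (d' := d') (by linarith) q3 (by linarith) hc (by omega) hd'
      hlt.le
    obtain ⟨x, y, hx, hy, p3⟩ :=
      hT.double_pos h (i := 3) (j := 0) (k := 1) (l := 2) (by decide) rfl rfl
    have hx0 := h.coeff_lt (r := 2) (s := 1) (u := 1) (v := c' + 1)
      (hT.no (i := 3) (by decide) rfl) hy le_rfl (by omega) p3
      (by rw [e2] at q0; linarith)
    have h2 : 0 < (α 2 : ℤ) - 2 := by
      have := h.two_le 2
      rcases this.lt_or_eq with h5 | h5
      · omega
      · have := (h.odd_alpha_iff p1).1 hp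
        rw [← h5] at this
        exact absurd this (by decide)
    -- As `α 2` is odd, `α 2 - 2 > 0`. By the sign of `y + 1 - c`, this relation contradicts the
    -- minimality of `α 0` or of `α 2`.
    have key : (α 2 - 2 : ℤ) * n 2 = (x - 1) * n 0 + (y + 1 - c) * n 1 := by
      rw [e1] at p2
      linear_combination p3 - p1 - p2 + p0
    rcases lt_or_ge (y + 1 - c) 0 with hneg | hpos
    · have hx1 : 0 < x - 1 := by
        have h5 := mul_pos h2 (h.pos 2)
        have h6 := mul_pos (neg_pos.2 hneg) (h.pos 1)
        exact pos_of_mul_pos_left (by linarith) (h.pos 0).le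
      have := h.le_of_eq (i := 0) (j := 2) (k := 1) (l := 3) (by decide) hx1
        (b := α 2 - 2) (c := -(y + 1 - c)) (d := 0) (by omega) (by omega) le_rfl (by linarith)
      omega
    · have := h.le_of_eq (i := 2) (j := 0) (k := 1) (l := 3) (by decide) h2
        (b := x - 1) (c := y + 1 - c) (d := 0) (by omega) (by omega) le_rfl (by linarith)
      omega
  · exact h.false_of_even (i := 0) (j := 3) (k := 2) (l := 1) (by decide) hp p0
      (c := c) (d := d) (c' := c') (d' := d') (by linarith) q3 (by linarith) p1 hc (by omega) hd'
      hlt.le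

theorem false_of_arcs_chain (h : FrobeniusPair n α p q)
    (hT : HasArcs n p (arcs [(0, 3), (1, 2), (2, 0), (3, 0), (3, 1)])) : False := by
  have hU := hT.reverse h
  have p0 := hT.single h (i := 0) (j := 3) (k := 1) (l := 2) (by decide) rfl rfl
  have p1 := hT.single h (i := 1) (j := 2) (k := 0) (l := 3) (by decide) rfl rfl
  have p2 := hT.single h (i := 2) (j := 0) (k := 1) (l := 3) (by decide) rfl rfl
  have q0 := hU.single h.symm (i := 0) (j := 1) (k := 2) (l := 3) (by decide) rfl rfl
  obtain ⟨d, c, hd, hc, q3⟩ :=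
    hU.double h.symm (i := 3) (j := 1) (k := 2) (l := 0) (by decide) rfl
  have h3 := h.two_le 3
  -- With `c' = 0` and `d' = α 3 - 1`, elimination yields `α 3 = 2`, so `p` is even.
  obtain ⟨-, e2, -⟩ := h.symm.eliminate (i := 0) (j := 1) (k := 3) (l := 2) (by decide) q0
      (c := c) (d := d) (c' := 0) (d' := α 3 - 1) (by linarith) p1 (by linarith) hc hd
      (by omega) (by omega)
  have hp : ¬ Odd p := by
    rw [h.odd_alpha_iff p0, show (α 3 : ℤ) = 2 by omega]
    decide
  have hα0 := (h.odd_alpha_iff p2).not.1 hp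
  have hα1 : Odd (α 1 : ℤ) := (h.symm.odd_alpha_iff q0).1 (h.odd_right_iff.2 hp)
  obtain ⟨x, y, hx, hy, p3⟩ :=
    hT.double h (i := 3) (j := 0) (k := 1) (l := 2) (by decide) rfl
  have hxy := (h.odd_iff_of_eq p3).not.1 hp
  have hyo : Odd y := by
    by_contra hyo
    refine h.not_even (i := 3) (j := 0) (k := 1) (l := 2) (by decide) (b := x + 1) (c := y)
      (d := 0) (by omega) hy le_rfl (by linarith) ((h.odd_alpha_iff p0).not.1 hp) ?_ hyo
      (by decide)
    rw [Int.odd_iff] at *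
    rw [Int.even_iff] at hxy
    omega
  obtain ⟨v, u, hv, hu, q1⟩ :=
    hU.double_pos h.symm (i := 1) (j := 2) (k := 0) (l := 3) (by decide) rfl rfl
  obtain ⟨z, y', hz, hy', q2⟩ :=
    hU.double_pos h.symm (i := 2) (j := 3) (k := 0) (l := 1) (by decide) rfl rfl
  have hz2 := h.symm.coeff_lt (r := 1) (s := 0) (u := y) (v := x + 1)
    (hU.no (i := 2) (by decide) rfl) hy' (by obtain ⟨m, hm⟩ := hyo; omega) (by omega) q2
    (by linarith)
  have hyα := h.coeff_lt (j := 1) (k := 0) (r := 2) (s := 0) (u := v) (v := u + 1) (a := y) (b := x)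
    (hT.no (i := 3) (by decide) rfl) hx hv (by omega) (by linarith) (by linarith)
  have hz1 : z = 1 := by omega
  have ha3 : (α 3 : ℤ) = 2 := by omega
  rw [hz1] at q2
  rw [ha3] at p0
  have key : (α 1 - 1 - y) * n 1 = (x + y' + 2 - α 0) * (n 0 : ℤ) := by
    linear_combination -q0 + q2 + p3 - p2
  -- `α 1` and `y` are odd, so the difference is odd; as `y < α 1`, it lies strictly between 0 and
  -- `α 1`, against minimality.
  have hne : (α 1 - 1 - y) ≠ 0 := by
    intro h0
    rw [Int.odd_iff] at *
    omega
  have hpos : 0 < (α 1 - 1 - y) := by omega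
  have := h.le_of_eq (i := 1) (j := 0) (k := 2) (l := 3) (by decide) hpos
    (b := x + y' + 2 - α 0) (c := 0) (d := 0)
    (by
      have := mul_pos hpos (h.pos 1)
      rw [key] at this
      exact (pos_of_mul_pos_left this (h.pos 0).le).le) le_rfl le_rfl (by linarith)
  omega

theorem false_of_arcs_seven (h : FrobeniusPair n α p q)
    (hT : HasArcs n p (arcs [(0, 3), (1, 2), (2, 0), (2, 3), (3, 1), (3, 2)])) : False := by
  have hU := hT.reverse h
  have p0 := hT.single h (i := 0) (j := 3) (k := 1) (l := 2) (by decide) rfl rfl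
  have q2 := hU.single h.symm (i := 2) (j := 0) (k := 1) (l := 3) (by decide) rfl rfl
  obtain ⟨a, b, ha, hb, p2⟩ :=
    hT.double_pos h (i := 2) (j := 3) (k := 0) (l := 1) (by decide) rfl rfl
  have ha3 : a ≤ α 3 - 1 := by
    by_contra hlt
    exact h.two_le_of_eq (i := 2) (j := 0) (k := 3) (l := 1) (by decide) (b := b + 1)
      (c := a - (α 3 - 1)) (d := 0) (by omega) (by omega) le_rfl (by linarith)
  -- This gives `α 0 ≤ b + 1`. Hence `p - (q + n 3)` is a combination of `n 3` and `n 0`, and `q + n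
  -- 3 ∈ S` puts `p` into `S`.
  have := h.le_of_eq (i := 0) (j := 2) (k := 3) (l := 1) (by decide) (a := b + 1)
    (b := 1) (c := α 3 - 1 - a) (d := 0) (by omega) (by omega) (by omega) le_rfl (by linarith)
  have h1 : p = q + n 3 + ((a - 1) * n 3 + (b - (α 0 - 1)) * n 0) := by
    linarith
  refine h.left_notMem ?_
  rw [h1]
  exact (h.right_add 3).add ((IsNatComb.mul (by omega) 3).add (IsNatComb.mul (by omega) 0))

theorem false_of_arcs_eight (h : FrobeniusPair n α p q)
    (hT : HasArcs n p (arcs [(0, 3), (1, 2), (2, 0), (2, 1), (3, 0), (3, 1)])) : False := by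
  have hU := hT.reverse h
  have p0 := hT.single h (i := 0) (j := 3) (k := 1) (l := 2) (by decide) rfl rfl
  have q0 := hU.single h.symm (i := 0) (j := 1) (k := 2) (l := 3) (by decide) rfl rfl
  have q1 := hU.single h.symm (i := 1) (j := 0) (k := 2) (l := 3) (by decide) rfl rfl
  obtain ⟨a, b, ha, hb, p3⟩ :=
    hT.double h (i := 3) (j := 0) (k := 1) (l := 2) (by decide) rfl
  have hq := h.symm.odd_of_two_cycle (i := 0) (j := 1) (k := 2) (l := 3) (by decide) q0 q1
  exact h.false_of_alpha_mul_eq (i := 0) (j := 1) (k := 3) (l := 2) (by decide) (by linarith)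
    ((h.symm.odd_alpha_iff q1).1 hq) ((h.symm.odd_alpha_iff q0).1 hq)
    ((h.odd_alpha_iff p0).not.1 (h.odd_right_iff.1 hq)) (a := a + 1) (by omega) hb (by linarith)

end FrobeniusPair

/-! ### Classification of the digraphs by enumeration -/

/-! Quantifiers over `Bool` and `Fin 4` which are cheap to evaluate. -/

def allBool (P : Bool → Bool) : Bool :=
  P false && P true

theorem allBool_eq_true {P : Bool → Bool} : allBool P = true ↔ ∀ b, P b = true := by
  simp [allBool, Bool.forall_bool]

def allVertices (P : Fin 4 → Bool) : Bool :=
  P 0 && P 1 && P 2 && P 3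

theorem allVertices_eq_true {P : Fin 4 → Bool} : allVertices P = true ↔ ∀ i, P i = true := by
  simp [allVertices, Fin.forall_fin_succ, and_assoc]

def anyVertex (P : Fin 4 → Bool) : Bool :=
  P 0 || P 1 || P 2 || P 3

theorem anyVertex_eq_true {P : Fin 4 → Bool} : anyVertex P = true ↔ ∃ i, P i = true := by
  simp [anyVertex, Fin.exists_fin_succ, or_assoc]

def countVertices (P : Fin 4 → Bool) : ℕ :=
  (P 0).toNat + (P 1).toNat + (P 2).toNat + (P 3).toNat

theorem countVertices_eq_card (P : Fin 4 → Bool) :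
    countVertices P = (Finset.univ.filter fun i => P i = true).card := by
  rw [Finset.card_filter, Fin.sum_univ_four, countVertices]
  congr 1
  · congr 1
    · congr 1
      · cases P 0 <;> rfl
      · cases P 1 <;> rfl
    · cases P 2 <;> rfl
  · cases P 3 <;> rfl

/-- The function on `Fin 4` with the given values. -/
def fourCases {β : Type*} (w x y z : β) (i : Fin 4) : β :=
  Nat.rec w (fun m _ => Nat.rec x (fun m _ => Nat.rec y (fun _ _ => z) m) m) i.val

theorem fourCases_eq {β : Type*} (w x y z : β) : fourCases w x y z = ![w, x, y, z] := by
  funext i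
  fin_cases i <;> rfl

/-- `j` is the only neighbour of `i`. -/
def isSource (T : Fin 4 → Fin 4 → Bool) (j i : Fin 4) : Bool :=
  T i j && Nat.beq (countVertices (T i)) 1

def hasNeighbours (T : Fin 4 → Fin 4 → Bool) : Bool :=
  allVertices fun i => anyVertex fun j => T i j

def hasFewSources (T U : Fin 4 → Fin 4 → Bool) : Bool :=
  allVertices fun j => Nat.ble (countVertices (isSource T j) + countVertices (isSource U j)) 1

/-- The digraphs of complementary pairs, up to relabelling and reversed complement. -/
def possibleArcs : List (List (Fin 4 × Fin 4)) :=
  [[(0, 3), (1, 2), (2, 0), (3, 1)],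
   [(0, 3), (1, 2), (2, 1), (3, 0)],
   [(0, 3), (1, 2), (2, 1), (3, 0), (3, 2)],
   [(0, 3), (1, 2), (2, 1), (2, 3), (3, 0), (3, 2)],
   [(0, 3), (1, 2), (2, 1), (2, 3), (3, 0), (3, 1)],
   [(0, 3), (1, 2), (2, 0), (3, 0), (3, 1)],
   [(0, 3), (1, 2), (2, 0), (2, 3), (3, 1), (3, 2)],
   [(0, 3), (1, 2), (2, 0), (2, 1), (3, 0), (3, 1)]]

def ofBits (a b c d e f g h i j k l : Bool) : Fin 4 → Fin 4 → Bool := fun r s =>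
  fourCases (fourCases false a b c s) (fourCases d false e f s) (fourCases g h false i s)
    (fourCases j k l false s) r

def matchesArcs (T : Fin 4 → Fin 4 → Bool) (σ : Fin 4 → Fin 4) (L : List (Fin 4 × Fin 4)) : Bool :=
  allVertices fun i => allVertices fun j => T (σ i) (σ j) == arcs L i j

/-- Up to relabelling, `T` is one of the digraphs of the list. -/
def isPossible (T : Fin 4 → Fin 4 → Bool) : Bool :=
  anyVertex fun d => anyVertex fun a => isSource T d a &&
    anyVertex fun c => c != a && c != d && anyVertex fun b => isSource T c b &&
      a != b && b != d && possibleArcs.any fun L => matchesArcs T (fourCases a b c d) L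

def isClassified (T U : Fin 4 → Fin 4 → Bool) : Bool :=
  !hasNeighbours T || !hasNeighbours U || !hasFewSources T U || isPossible T || isPossible U

/-- The twelve bits are the off-diagonal entries, row by row; the second argument is the reversed
complement of the first. -/
theorem isClassified_ofBits : ∀ a b c d e f g h i j k l : Bool,
    isClassified (ofBits a b c d e f g h i j k l)
      (ofBits (!d) (!g) (!j) (!a) (!h) (!k) (!b) (!e) (!l) (!c) (!f) (!i)) = true := by
  simp only [← allBool_eq_true]
  decide +kernel

/-! ### From the classification to the directed cycle -/

namespace FrobeniusPair

variable {n α : Fin 4 → ℕ} {p q : ℤ} {i j k l : Fin 4}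

/-- Without neighbours `p + n i = 0`, and then `p + n j ∈ S` makes `n j` a combination of the others
in which `n i` occurs. -/
theorem exists_neighbour (h : FrobeniusPair n α p q) (i : Fin 4) :
    ∃ j, i ≠ j ∧ IsNatComb n (p + n i - n j) := by
  obtain ⟨j, k, l, hl⟩ : ∃ j k l, IsLabelling i j k l := by revert i; decide
  by_contra hc
  push Not at hc
  have hl' := hl
  obtain ⟨g1, g2, g3, g4, g5, g6⟩ := hl'
  obtain ⟨a, b, c, ha, hb, hc', he⟩ := h.exists_row hl
  have ha0 := h.coeff_eq_zero (i := i) (j := j) (i' := l) (k := k) (l := l) (d := 0)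
    (hc j g1) ha hb hc' le_rfl (by linarith)
  have hb0 := h.coeff_eq_zero (i := i) (j := k) (i' := l) (k := j) (l := l) (d := 0)
    (hc k g2) hb ha hc' le_rfl (by linarith)
  have hc0 := h.coeff_eq_zero (i := i) (j := l) (i' := l) (k := j) (l := k) (d := 0)
    (hc l g3) hc' ha hb le_rfl (by linarith)
  subst ha0 hb0 hc0
  obtain ⟨a, b, c, ha, hb, hc', he'⟩ := h.exists_row (i := j) (j := i) (k := k) (l := l)
    ⟨g1.symm, g4, g5, g2, g3, g6⟩
  exact h.two_le_of_eq (i := j) (j := i) (k := k) (l := l) ⟨g1.symm, g4, g5, g2, g3, g6⟩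
    (b := a + 1) (by omega) hb hc' (by linarith)

end FrobeniusPair

theorem exists_labelling_of_ne {i j : Fin 4} (h : i ≠ j) : ∃ k l, IsLabelling i j k l := by
  revert i j; decide

theorem eq_false_of_countVertices_eq_one {T : Fin 4 → Fin 4 → Bool} {i j k l : Fin 4} (hl : IsLabelling i j k l)
    (hi : T i i = false) (hj : T i j = true) (h : countVertices (T i) = 1) :
    T i k = false ∧ T i l = false := by
  have key : ∀ (t : Fin 4 → Bool) (i j k l : Fin 4), IsLabelling i j k l → t i = false →
      t j = true → (t 0).toNat + (t 1).toNat + (t 2).toNat + (t 3).toNat = 1 →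
      t k = false ∧ t l = false := by decide
  exact key (T i) i j k l hl hi hj h

theorem isSource_eq_true {T : Fin 4 → Fin 4 → Bool} {i j : Fin 4} :
    isSource T j i = true ↔ T i j = true ∧ countVertices (T i) = 1 := by
  simp only [isSource, Bool.and_eq_true, Nat.beq_eq]

theorem countVertices_le_one {P : Fin 4 → Bool}
    (h : ∀ x y, P x = true → P y = true → x = y) : countVertices P ≤ 1 := by
  rw [countVertices_eq_card, Finset.card_le_one]
  intro x hx y hy
  simp only [Finset.mem_filter, Finset.mem_univ, true_and] at hx hy
  exact h x y hx hy

theorem exists_of_countVertices_pos {P : Fin 4 → Bool} (h : 0 < countVertices P) :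
    ∃ x, P x = true := by
  rw [countVertices_eq_card, Finset.card_pos] at h
  obtain ⟨x, hx⟩ := h
  exact ⟨x, (Finset.mem_filter.1 hx).2⟩

theorem exists_perm_of_isPossible {T : Fin 4 → Fin 4 → Bool} (hT : ∀ i, T i i = false)
    (h : isPossible T = true) :
    ∃ σ : Equiv.Perm (Fin 4), ∃ L ∈ possibleArcs, ∀ i j, T (σ i) (σ j) = arcs L i j := by
  simp only [isPossible, anyVertex_eq_true, List.any_eq_true, Bool.and_eq_true, bne_iff_ne, ne_eq,
    fourCases_eq] at h
  obtain ⟨d, a, ha, c, ⟨hca, hcd⟩, b, ⟨⟨hb, hab⟩, hbd⟩, L, hL, hm⟩ := h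
  have had : a ≠ d := by
    rintro rfl
    have := (isSource_eq_true.1 ha).1
    simp [hT] at this
  have hbc : b ≠ c := by
    rintro rfl
    have := (isSource_eq_true.1 hb).1
    simp [hT] at this
  have hinj : Function.Injective ![a, b, c, d] := by
    intro x y hxy
    fin_cases x <;> fin_cases y <;> simp_all
  refine ⟨Equiv.ofBijective _ ((Fintype.bijective_iff_injective_and_card _).2 ⟨hinj, rfl⟩), L, hL,
    fun i j => ?_⟩
  simp only [matchesArcs, allVertices_eq_true] at hm
  simpa using hm i j

namespace HasArcs

variable {n α : Fin 4 → ℕ} {p q : ℤ} {T U : Fin 4 → Fin 4 → Bool} {i j k l : Fin 4}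

theorem eq_of_isSource (hT : HasArcs n p T) (h : FrobeniusPair n α p q)
    (hd : ∀ i, T i i = false) (hi : isSource T j i = true) : p + n i = (α j - 1 : ℤ) * n j := by
  obtain ⟨h1, h2⟩ := isSource_eq_true.1 hi
  have hij : i ≠ j := by
    rintro rfl
    simp [hd] at h1
  obtain ⟨k, l, hl⟩ := exists_labelling_of_ne hij
  obtain ⟨h3, h4⟩ := eq_false_of_countVertices_eq_one hl (hd i) h1 h2
  exact hT.single h hl h3 h4

theorem countVertices_isSource_le (hT : HasArcs n p T) (h : FrobeniusPair n α p q)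
    (hd : ∀ i, T i i = false) (j : Fin 4) : countVertices (isSource T j) ≤ 1 := by
  refine countVertices_le_one fun x y hx hy => ?_
  by_contra hxy
  obtain ⟨k, l, hl⟩ := exists_labelling_of_ne hxy
  exact h.single_injective hl (hT.eq_of_isSource h hd hx) (hT.eq_of_isSource h hd hy)

/-- Two sources of `j` in one digraph would be equal generators. One in each digraph would give `α
j` the parity of both `p` and `q`. -/
theorem hasFewSources (hT : HasArcs n p T) (hU : HasArcs n q U) (h : FrobeniusPair n α p q)
    (hd : ∀ i, T i i = false) (hd' : ∀ i, U i i = false) : hasFewSources T U = true := by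
  simp only [_root_.hasFewSources, allVertices_eq_true, Nat.ble_eq]
  intro j
  have h1 := hT.countVertices_isSource_le h hd j
  have h2 := hU.countVertices_isSource_le h.symm hd' j
  by_contra hc
  obtain ⟨x, hx⟩ : ∃ x, isSource T j x = true := exists_of_countVertices_pos (by omega)
  obtain ⟨y, hy⟩ : ∃ y, isSource U j y = true := exists_of_countVertices_pos (by omega)
  have e1 := h.odd_alpha_iff (hT.eq_of_isSource h hd hx)
  have e2 := h.symm.odd_alpha_iff (hU.eq_of_isSource h.symm hd' hy)
  have e3 := h.odd_right_iff
  tauto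

theorem hasNeighbours (hT : HasArcs n p T) (h : FrobeniusPair n α p q) :
    hasNeighbours T = true := by
  simp only [_root_.hasNeighbours, allVertices_eq_true, anyVertex_eq_true]
  intro i
  obtain ⟨j, hij, hj⟩ := h.exists_neighbour i
  exact ⟨j, (hT i j hij).1 hj⟩

end HasArcs

theorem eq_ofBits {T : Fin 4 → Fin 4 → Bool} (hd : ∀ i, T i i = false) :
    T = ofBits (T 0 1) (T 0 2) (T 0 3) (T 1 0) (T 1 2) (T 1 3) (T 2 0) (T 2 1) (T 2 3)
      (T 3 0) (T 3 1) (T 3 2) := by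
  funext i j
  fin_cases i <;> fin_cases j <;> simp [ofBits, fourCases_eq, hd]

namespace FrobeniusPair

variable {n α : Fin 4 → ℕ} {p q : ℤ}

theorem hasArcs_cycle (h : FrobeniusPair n α p q) {L : List (Fin 4 × Fin 4)}
    (hL : L ∈ possibleArcs) (hT : HasArcs n p (arcs L)) :
    ∃ σ : Equiv.Perm (Fin 4), HasArcs (n ∘ σ) p (fun i j => j == i + 1) := by
  simp only [possibleArcs, List.mem_cons, List.not_mem_nil, or_false] at hL
  rcases hL with rfl | rfl | rfl | rfl | rfl | rfl | rfl | rfl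
  · let σ : Equiv.Perm (Fin 4) := ⟨![0, 3, 1, 2], ![0, 2, 3, 1], by decide, by decide⟩
    refine ⟨σ, fun i j hij => ?_⟩
    rw [hT.comp σ i j hij]
    revert i j
    decide
  · exact (h.false_of_arcs_two_cycles hT).elim
  · exact (h.false_of_arcs_two_cycle hT).elim
  · exact (h.false_of_arcs_path hT).elim
  · exact (h.false_of_arcs_four hT).elim
  · exact (h.false_of_arcs_chain hT).elim
  · exact (h.false_of_arcs_seven hT).elim
  · exact (h.false_of_arcs_eight hT).elim

theorem hasArcs_cycle_of_isPossible (h : FrobeniusPair n α p q) {T : Fin 4 → Fin 4 → Bool}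
    (hT : HasArcs n p T) (hd : ∀ i, T i i = false) (hp : isPossible T = true) :
    ∃ σ : Equiv.Perm (Fin 4), HasArcs (n ∘ σ) p (fun i j => j == i + 1) := by
  obtain ⟨σ, L, hL, he⟩ := exists_perm_of_isPossible hd hp
  obtain ⟨τ, hτ⟩ := (h.comp σ).hasArcs_cycle hL (by
    intro i j hij
    rw [hT.comp σ i j hij, ← he])
  exact ⟨τ.trans σ, hτ⟩

/-- One of the two digraphs is a directed cycle of length four. -/
theorem exists_cycle (h : FrobeniusPair n α p q) :
    ∃ σ : Equiv.Perm (Fin 4), HasArcs (n ∘ σ) p (fun i j => j == i + 1) ∨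
      HasArcs (n ∘ σ) q (fun i j => j == i + 1) := by
  classical
  let T : Fin 4 → Fin 4 → Bool := fun i j => decide (i ≠ j ∧ IsNatComb n (p + n i - n j))
  let U : Fin 4 → Fin 4 → Bool := fun i j => decide (i ≠ j ∧ IsNatComb n (q + n i - n j))
  have hT : HasArcs n p T := fun i j hij => by simp [T, hij]
  have hU : HasArcs n q U := fun i j hij => by simp [U, hij]
  have hdT : ∀ i, T i i = false := fun i => by simp [T]
  have hdU : ∀ i, U i i = false := fun i => by simp [U]
  have hUT : ∀ i j, i ≠ j → U i j = !T j i := by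
    intro i j hij
    have h1 := (hU i j hij).symm.trans (hT.reverse h i j hij)
    exact Bool.eq_iff_iff.2 h1
  have key := isClassified_ofBits (T 0 1) (T 0 2) (T 0 3) (T 1 0) (T 1 2) (T 1 3) (T 2 0) (T 2 1)
    (T 2 3) (T 3 0) (T 3 1) (T 3 2)
  have hU' := eq_ofBits hdU
  rw [hUT 0 1 (by decide), hUT 0 2 (by decide), hUT 0 3 (by decide), hUT 1 0 (by decide),
    hUT 1 2 (by decide), hUT 1 3 (by decide), hUT 2 0 (by decide), hUT 2 1 (by decide),
    hUT 2 3 (by decide), hUT 3 0 (by decide), hUT 3 1 (by decide), hUT 3 2 (by decide)] at hU'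
  rw [← eq_ofBits hdT, ← hU'] at key
  simp only [isClassified, hT.hasNeighbours h, hU.hasNeighbours h.symm,
    hT.hasFewSources hU h hdT hdU, Bool.not_true, Bool.false_or, Bool.or_eq_true] at key
  rcases key with hp | hp
  · obtain ⟨σ, hσ⟩ := h.hasArcs_cycle_of_isPossible hT hdT hp
    exact ⟨σ, Or.inl hσ⟩
  · obtain ⟨σ, hσ⟩ := h.symm.hasArcs_cycle_of_isPossible hU hdU hp
    exact ⟨σ, Or.inr hσ⟩

/-- If the digraph of `p` is a directed cycle, then `q = 2 p`. -/
theorem right_eq_two_mul (h : FrobeniusPair n α p q)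
    (hT : HasArcs n p (fun i j => j == i + 1)) : q = 2 * p := by
  have hU := hT.reverse h
  have hlab : ∀ i : Fin 4, IsLabelling i (i + 1) (i + 2) (i + 3) := by decide
  have hlab' : ∀ i : Fin 4, IsLabelling i (i + 2) (i + 1) (i + 3) := by decide
  have hlab2 : ∀ i : Fin 4, IsLabelling (i + 1) i (i + 2) (i + 3) := by decide
  have hlab3 : ∀ i : Fin 4, IsLabelling (i + 1) (i + 2) (i + 3) i := by decide
  have b1 : ∀ i : Fin 4, (i + 2 == i + 1) = false := by decide
  have b2 : ∀ i : Fin 4, (i + 3 == i + 1) = false := by decide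
  have b3 : ∀ i : Fin 4, (!(i == i + 3 + 1)) = false := by decide
  have b4 : ∀ i : Fin 4, (!(i == i + 2 + 1)) = true := by decide
  have a1 : ∀ i : Fin 4, i + 1 + 1 = i + 2 := by decide
  have a2 : ∀ i : Fin 4, i + 2 + 1 = i + 3 := by decide
  have a3 : ∀ i : Fin 4, i + 1 + 2 = i + 3 := by decide
  have hp : ∀ i : Fin 4, p + n i = (α (i + 1) - 1 : ℤ) * n (i + 1) := fun i =>
    hT.single h (hlab i) (b1 i) (b2 i)
  have hq : ∀ i : Fin 4, ∃ b a : ℤ, 1 ≤ b ∧ 0 ≤ a ∧ q + n i = b * n (i + 2) + a * n (i + 1) :=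
    fun i => hU.double_pos h.symm (hlab' i) (b3 i) (b4 i)
  choose b a hb ha hq using hq
  -- `α (i+2) n (i+2) = (α (i+3) - 1) n (i+3) + n (i+1)`, and `i + 3` is not a neighbour of `i` for
  -- `q`.
  have hlt : ∀ i, b i < α (i + 2) := fun i => by
    have e1 := hp (i + 1)
    have e2 := hp (i + 2)
    have e3 := h.two_le (i + 3)
    rw [a1] at e1
    rw [a2] at e2
    refine h.symm.coeff_lt (r := i + 3) (s := i + 1) (u := α (i + 3) - 1) (v := 1)
      (hU.no (hlab i).2.2.1 (b3 i)) (ha i) (by omega) zero_le_one (hq i) (by linarith)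
  have ha2 : ∀ i, a i ≤ α (i + 1) - 2 := fun i => by
    by_contra hc
    have e := hp i
    refine h.right_notMem ?_
    have e4 : q = p + n (i + 2) + ((b i - 1) * n (i + 2) + (a i - (α (i + 1) - 1)) * n (i + 1)) := by
      linarith [hq i]
    rw [e4]
    exact (h.left_add (i + 2)).add
      ((IsNatComb.mul (by linarith [hb i]) _).add (IsNatComb.mul (by omega) _))
  have hba : ∀ i, a (i + 1) < b i := fun i => by
    by_contra hc
    have e1 := hq i
    have e2 := hq (i + 1)
    have := ha2 i
    rw [a1, a3] at e2
    have := h.le_of_eq (i := i + 1) (j := i) (k := i + 2) (l := i + 3)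
      (hlab2 i) (a := a i + 1) (by linarith [ha i]) (b := 1)
      (c := a (i + 1) - b i) (d := b (i + 1)) zero_le_one (by omega) (by linarith [hb (i + 1)])
      (by linarith)
    omega
  -- Twice `p` has the expression `2p + n i = (α (i+1) - 2) n (i+1) + (α (i+2) - 1) n (i+2)`; the
  -- goal is that `q + n i` has the same coefficients.
  have hs : ∀ i, 2 * p - q = (α (i + 1) - 2 - a i) * n (i + 1) +
      (α (i + 2) - 1 - b i) * n (i + 2) := fun i => by
    have e1 := hp i
    have e2 := hp (i + 1)
    rw [a1] at e2
    linarith [hq i]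
  -- Equating `hs i` with `hs (i + 1)` expresses this multiple of `n (i+1)`, smaller than the `α
  -- (i+1)`-fold, by `n (i+2)` and `n (i+3)`; `hba` makes the coefficient of `n (i+2)` nonnegative.
  have hy : ∀ i, (α (i + 1) - 2 - a i : ℤ) = 0 := fun i => by
    by_contra hc
    have e1 := hs i
    have e2 := hs (i + 1)
    have e3 := hlt (i + 1)
    have e4 := hba i
    have e5 := ha2 i
    have e6 := ha i
    rw [a1, a3] at e2
    rw [a3] at e3
    have := h.le_of_eq (i := i + 1) (j := i + 2) (k := i + 3) (l := i)
      (hlab3 i) (a := α (i + 1) - 2 - a i) (by omega)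
      (b := (α (i + 2) - 2 - a (i + 1)) - (α (i + 2) - 1 - b i))
      (c := α (i + 3) - 1 - b (i + 1)) (d := 0) (by omega) (by omega) le_rfl (by linarith)
    omega
  have hx : (α (0 + 2) - 1 - b 0 : ℤ) = 0 := by
    have e1 := hy 1
    have e2 := hba 0
    have e3 := hlt 0
    simp only [zero_add, show (1 + 1 : Fin 4) = 2 from rfl] at *
    omega
  have := hs 0
  rw [hy, hx] at this
  linarith

end FrobeniusPair

/-! ### From almost symmetric semigroups to complementary pairs -/

theorem mem_spanOthers_iff {n : Fin 4 → ℕ} {i : Fin 4} {a : ℕ} :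
    a ∈ spanOthers n i ↔ ∃ d : Fin 4 → ℕ, d i = 0 ∧ a = ∑ j, d j * n j := by
  constructor
  · intro h
    induction h using AddSubmonoid.closure_induction with
    | mem x hx =>
      obtain ⟨j, hj, rfl⟩ := hx
      exact ⟨fun k => if k = j then 1 else 0, by simp [Ne.symm hj], by simp⟩
    | zero => exact ⟨0, rfl, by simp⟩
    | add x y _ _ hx hy =>
      obtain ⟨c, hc, rfl⟩ := hx
      obtain ⟨d, hd, rfl⟩ := hy
      exact ⟨c + d, by simp [hc, hd], by simp [add_mul, Finset.sum_add_distrib]⟩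
  · rintro ⟨d, hd, rfl⟩
    refine sum_mem fun j _ => ?_
    by_cases hj : j = i
    · subst hj; simp [hd]
    · rw [← smul_eq_mul]
      exact nsmul_mem (AddSubmonoid.subset_closure (Set.mem_image_of_mem n hj)) _

theorem mem_closure_range_iff_isNatComb {n : Fin 4 → ℕ} {a : ℕ} :
    a ∈ AddSubmonoid.closure (Set.range n) ↔ IsNatComb n a := by
  constructor
  · intro h
    induction h using AddSubmonoid.closure_induction with
    | mem x hx =>
      obtain ⟨j, rfl⟩ := hx
      exact IsNatComb.gen j
    | zero => exact IsNatComb.zero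
    | add x y _ _ hx hy => push_cast; exact hx.add hy
  · rintro ⟨d, hd⟩
    have : a = ∑ j, d j * n j := by exact_mod_cast hd
    rw [this]
    refine sum_mem fun j _ => ?_
    rw [← smul_eq_mul]
    exact nsmul_mem (AddSubmonoid.subset_closure (Set.mem_range_self j)) _

theorem IsNatComb.nonneg {n : Fin 4 → ℕ} {z : ℤ} (h : IsNatComb n z) : 0 ≤ z := by
  obtain ⟨c, rfl⟩ := h
  positivity

theorem mem_intPoints_iff {S : AddSubmonoid ℕ} {n : Fin 4 → ℕ} (hn : IsMinimalGenerators S n)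
    {z : ℤ} : z ∈ intPoints S ↔ IsNatComb n z := by
  constructor
  · rintro ⟨a, ha, rfl⟩
    rw [hn.1] at ha
    exact mem_closure_range_iff_isNatComb.1 ha
  · intro h
    have := h.nonneg
    lift z to ℕ using this
    refine ⟨z, ?_, rfl⟩
    rw [hn.1]
    exact mem_closure_range_iff_isNatComb.2 h

theorem alphaNumber_spec {n : Fin 4 → ℕ} (hn : ∀ i, 0 < n i) (i : Fin 4) :
    0 < alphaNumber n i ∧ alphaNumber n i * n i ∈ spanOthers n i := by
  refine Nat.sInf_mem (s := {a : ℕ | 0 < a ∧ a * n i ∈ spanOthers n i}) ⟨n (i + 1), hn _, ?_⟩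
  rw [mul_comm, ← smul_eq_mul]
  have hi : ∀ i : Fin 4, i + 1 ≠ i := by decide
  exact nsmul_mem (AddSubmonoid.subset_closure (Set.mem_image_of_mem n (hi i))) _

theorem alphaNumber_comp (n : Fin 4 → ℕ) (σ : Equiv.Perm (Fin 4)) :
    alphaNumber (n ∘ σ) = alphaNumber n ∘ σ := by
  have : ∀ i, spanOthers (n ∘ σ) i = spanOthers n (σ i) := by
    intro i
    unfold spanOthers
    congr 1
    ext x
    constructor
    · rintro ⟨j, hj, rfl⟩
      exact ⟨σ j, σ.injective.ne hj, rfl⟩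
    · rintro ⟨j, hj, rfl⟩
      refine ⟨σ.symm j, fun h => hj ?_, by simp⟩
      rw [← h]; simp
  funext i
  simp only [alphaNumber, this, Function.comp]

/-- If `f < 0` and `n i` is the smallest generator, then `f + n i ∈ S` is below `n i`, hence zero.
For another `j`, `n j = (f + n j) + n i` contradicts minimal generation. -/
theorem pseudoFrobenius_nonneg {S : AddSubmonoid ℕ} {n : Fin 4 → ℕ}
    (hn : IsMinimalGenerators S n) (hpos : ∀ i, 0 < n i) {f : ℤ} (hf : f ∈ pseudoFrobenius S) :
    0 ≤ f := by
  by_contra hneg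
  push Not at hneg
  obtain ⟨i, -, hi⟩ := Finset.exists_min_image Finset.univ n ⟨0, Finset.mem_univ _⟩
  have hmem : ∀ j, IsNatComb n (f + n j) := fun j => by
    rw [← mem_intPoints_iff hn]
    refine hf.2 (n j) ?_ (hpos j).ne'
    rw [hn.1]
    exact AddSubmonoid.subset_closure ⟨j, rfl⟩
  have hzero : f + n i = 0 := by
    obtain ⟨c, hc⟩ := hmem i
    have hc0 : ∀ j, c j = 0 := by
      intro j
      by_contra hne
      have h1 : (c j : ℤ) * n j ≤ ∑ k, (c k : ℤ) * n k :=
        Finset.single_le_sum (f := fun k => (c k : ℤ) * n k) (fun k _ => by positivity)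
          (Finset.mem_univ j)
      have h2 : (n j : ℤ) ≤ c j * n j := by
        have : 1 ≤ c j := by omega
        nlinarith [hpos j]
      have h3 := hi j (Finset.mem_univ _)
      omega
    rw [hc]
    simp [hc0]
  obtain ⟨j, hij⟩ := exists_ne i
  refine hn.2 j (mem_spanOthers_iff.2 ?_)
  obtain ⟨c, hc⟩ := hmem j
  have hsum : (n j : ℤ) = ∑ k, (c k : ℤ) * n k + n i := by omega
  have hcj : c j = 0 := by
    by_contra hne
    have h1 : (c j : ℤ) * n j ≤ ∑ k, (c k : ℤ) * n k :=
      Finset.single_le_sum (f := fun k => (c k : ℤ) * n k) (fun k _ => by positivity)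
        (Finset.mem_univ j)
    have h2 : (n j : ℤ) ≤ c j * n j := by
      have : 1 ≤ c j := by omega
      nlinarith [hpos j]
    have h3 := hpos i
    omega
  refine ⟨fun k => c k + if k = i then 1 else 0, by simp [hcj, hij], ?_⟩
  zify
  rw [hsum]
  simp [add_mul, Finset.sum_add_distrib]

theorem frobeniusNumber_mem_pseudoFrobenius {S : AddSubmonoid ℕ} (hS : IsNumericalSemigroup S) :
    frobeniusNumber S ∈ pseudoFrobenius S := by
  have hF := isGreatest_frobeniusNumber S hS
  refine ⟨hF.1, fun s _ hs0 => ?_⟩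
  by_contra hc
  have := hF.2 hc
  omega

/-- In an almost symmetric semigroup, an integer outside of `S` whose complement with respect to
`F(S)` does not lie in `S` is a pseudo-Frobenius number. -/
theorem mem_or_mem_of_isAlmostSymmetric {S : AddSubmonoid ℕ} (hS : IsNumericalSemigroup S)
    (hnonneg : ∀ f ∈ pseudoFrobenius S, 0 ≤ f) (has : IsAlmostSymmetric S)
    (hfin : (pseudoFrobenius S).Finite) {z : ℤ} (hz : z ∉ intPoints S) :
    frobeniusNumber S - z ∈ intPoints S ∨ z ∈ pseudoFrobenius S \ {frobeniusNumber S} := by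
  have hF := isGreatest_frobeniusNumber S hS
  have hFPF := frobeniusNumber_mem_pseudoFrobenius hS
  set F := frobeniusNumber S with hFdef
  by_cases hz0 : z < 0
  · left
    by_contra hc
    have := hF.2 hc
    omega
  push Not at hz0
  have hS0 : ∀ z ∈ intPoints S, 0 ≤ z := by
    rintro _ ⟨a, -, rfl⟩
    simp
  set G : Set ℤ := Set.Icc 0 F \ intPoints S with hG
  set N : Set ℤ := Set.Icc 0 F ∩ intPoints S with hN
  have hIfin : (Set.Icc 0 F).Finite := Set.finite_Icc 0 F
  have hGfin : G.Finite := hIfin.subset Set.sdiff_subset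
  have hNfin : N.Finite := hIfin.subset Set.inter_subset_left
  have hGcard : G.ncard = genus S := by
    have : G = (fun a : ℕ => (a : ℤ)) '' {a : ℕ | a ∉ S} := by
      ext x
      constructor
      · rintro ⟨⟨h0, -⟩, hx⟩
        lift x to ℕ using h0
        exact ⟨x, fun hxS => hx ⟨x, hxS, rfl⟩, rfl⟩
      · rintro ⟨a, ha, rfl⟩
        have ha' : (a : ℤ) ∉ intPoints S := by
          rintro ⟨b, hb, hab⟩
          have : b = a := Nat.cast_injective hab
          exact ha (this ▸ hb)
        exact ⟨⟨by simp, hF.2 ha'⟩, ha'⟩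
    rw [this, Set.ncard_image_of_injective _ Nat.cast_injective, genus]
  have hcard : G.ncard + N.ncard = (F + 1).toNat := by
    have h1 : (Set.Icc 0 F).ncard = (F + 1).toNat := by
      rw [← Nat.card_coe_set_eq]
      simp
    rw [← h1, add_comm, hG, hN]
    exact Set.ncard_inter_add_ncard_sdiff_eq_ncard _ _ hIfin
  -- `s ↦ F - s` embeds the elements of `S` up to `F` into the gaps; the pseudo-Frobenius numbers
  -- other than `F` are among the gaps that are missed.
  set N' : Set ℤ := (fun s => F - s) '' N with hN'
  have hN'card : N'.ncard = N.ncard :=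
    Set.ncard_image_of_injective _ (sub_right_injective)
  have hN'G : N' ⊆ G := by
    rintro _ ⟨s, ⟨⟨h0, h1⟩, a, ha, rfl⟩, rfl⟩
    refine ⟨⟨by simp only at *; omega, by simp only at *; omega⟩, ?_⟩
    rintro ⟨b, hb, hab⟩
    exact hF.1 ⟨b + a, add_mem hb ha, by simp only at *; omega⟩
  have hPG : pseudoFrobenius S \ {F} ⊆ G \ N' := by
    rintro f ⟨hf, hfF⟩
    have hfle := hF.2 hf.1
    refine ⟨⟨⟨hnonneg f hf, hfle⟩, hf.1⟩, ?_⟩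
    rintro ⟨s, ⟨-, a, ha, rfl⟩, hs⟩
    have ha0 : a ≠ 0 := by
      rintro rfl
      exact hfF (by simp only at hs; simp at hs ⊢; omega)
    have := hf.2 a ha ha0
    rw [show f + (a : ℤ) = F by simp only at hs; omega] at this
    exact hF.1 this
  have hdiff : (G \ N').ncard + N'.ncard = G.ncard := Set.ncard_sdiff_add_ncard_of_subset hN'G hGfin
  have hPcard : (pseudoFrobenius S \ {F}).ncard + 1 = (pseudoFrobenius S).ncard :=
    Set.ncard_sdiff_singleton_add_one hFPF hfin
  -- The number of missed gaps is `2g - (F + 1)`, which is `t - 1` by almost symmetry; so the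
  -- inclusion `hPG` is an equality.
  have hle : (G \ N').ncard ≤ (pseudoFrobenius S \ {F}).ncard := by
    have := has
    unfold IsAlmostSymmetric semigroupType at this
    have := hnonneg F hFPF
    omega
  have heq := Set.eq_of_subset_of_ncard_le hPG hle (hGfin.subset Set.sdiff_subset)
  by_cases hzN : z ∈ N'
  · obtain ⟨s, ⟨-, hs⟩, rfl⟩ := hzN
    left
    simpa using hs
  · right
    rw [heq]
    exact ⟨⟨⟨hz0, hF.2 hz⟩, hz⟩, hzN⟩

theorem exists_frobeniusPair {S : AddSubmonoid ℕ} (hS : IsNumericalSemigroup S)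
    {n : Fin 4 → ℕ} (hn : IsMinimalGenerators S n) (hodd : ∀ i, Odd (n i))
    (has : IsAlmostSymmetric S) (ht : semigroupType S = 3) :
    ∃ p q, FrobeniusPair n (alphaNumber n) p q := by
  have hpos : ∀ i, 0 < n i := fun i => (hodd i).pos
  have hnonneg : ∀ f ∈ pseudoFrobenius S, 0 ≤ f := fun f => pseudoFrobenius_nonneg hn hpos
  have ht' : (pseudoFrobenius S).ncard = 3 := ht
  have hfin : (pseudoFrobenius S).Finite := Set.finite_of_ncard_ne_zero (by omega)
  have hFPF := frobeniusNumber_mem_pseudoFrobenius hS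
  have hdual := fun z => mem_or_mem_of_isAlmostSymmetric hS hnonneg has hfin (z := z)
  have hF := isGreatest_frobeniusNumber S hS
  have h2 : (pseudoFrobenius S \ {frobeniusNumber S}).ncard = 2 := by
    have := Set.ncard_sdiff_singleton_add_one hFPF hfin
    omega
  have hFodd : Odd (frobeniusNumber S) := by
    unfold IsAlmostSymmetric at has
    rw [ht] at has
    rw [Int.odd_iff]
    push_cast at has
    omega
  set F := frobeniusNumber S
  obtain ⟨p, q, hpq, hPF⟩ := Set.ncard_eq_two.1 h2
  rw [hPF] at hdual
  have hp : p ∈ pseudoFrobenius S \ {F} := by rw [hPF]; simp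
  have hq : q ∈ pseudoFrobenius S \ {F} := by rw [hPF]; simp
  -- `F - p` is a gap whose reflection `p` is not in `S`, so it is `p` or `q`; it is not `p` because
  -- `F` is odd.
  have hsum : p + q = F := by
    have h1 : F - p ∉ intPoints S := by
      rintro ⟨a, ha, hap⟩
      simp only at hap
      have ha0 : a ≠ 0 := by
        rintro rfl
        exact hp.2 (by simp at hap ⊢; omega)
      have := hp.1.2 a ha ha0
      rw [hap] at this
      exact hF.1 (by simpa using this)
    rcases hdual _ h1 with h3 | h3 | h3
    · rw [sub_sub_cancel] at h3
      exact (hp.1.1 h3).elim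
    · rw [Int.odd_iff] at hFodd
      omega
    · have h3' : F - p = q := h3
      omega
  have hmem : ∀ i, n i ∈ S := fun i => by
    rw [hn.1]
    exact AddSubmonoid.subset_closure ⟨i, rfl⟩
  have hne : ∀ i j, i ≠ j → n i ≠ n j := by
    intro i j hij h
    refine hn.2 i ?_
    rw [h]
    exact AddSubmonoid.subset_closure ⟨j, hij.symm, rfl⟩
  have hoddZ : ∀ i, Odd (n i : ℤ) := fun i => by exact_mod_cast hodd i
  refine ⟨p, q, hoddZ, hsum ▸ hFodd, fun i => ?_, fun i c d hc hd hs => ?_, fun i => ?_, ?_, ?_, ?_,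
    fun i => ?_, fun i => ?_, fun i j hij hc => ?_⟩
  · have h1 := alphaNumber_spec hpos i
    have h3 : alphaNumber n i ≠ 1 := by
      intro h3
      rw [h3, one_mul] at h1
      exact hn.2 i h1.2
    have : 2 ≤ alphaNumber n i := by omega
    exact_mod_cast this
  · refine Nat.sInf_le ⟨hc, mem_spanOthers_iff.2 ⟨d, hd, ?_⟩⟩
    exact_mod_cast hs
  · obtain ⟨d, hd, he⟩ := mem_spanOthers_iff.1 (alphaNumber_spec hpos i).2
    exact ⟨d, hd, by exact_mod_cast he⟩
  · rw [← mem_intPoints_iff hn]; exact hp.1.1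
  · rw [← mem_intPoints_iff hn]; exact hq.1.1
  · rw [← mem_intPoints_iff hn, hsum]; exact hF.1
  · rw [← mem_intPoints_iff hn]; exact hp.1.2 _ (hmem i) (hpos i).ne'
  · rw [← mem_intPoints_iff hn]; exact hq.1.2 _ (hmem i) (hpos i).ne'
  -- The gap `p + n i - n j` is not `p`, as the generators are distinct, nor `q`, which has the
  -- other parity; so its reflection lies in `S`.
  · rw [← mem_intPoints_iff hn] at hc ⊢
    rcases hdual _ hc with h3 | h3 | h3
    · rwa [← hsum, show p + q - (p + n i - n j) = q + n j - n i by ring] at h3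
    · have := hne i j hij
      omega
    · have h3' : p + n i - n j = q := h3
      have h4 := hoddZ i
      have h5 := hoddZ j
      rw [Int.odd_iff] at *
      omega

/-! ### Normal forms of monomials -/

/-- The exponents of the monomials in three variables which are not reducible. -/
def normalExponents (α : Fin 4 → ℕ) : Finset (ℕ × ℕ × ℕ) :=
  insert (α 1 - 1, 0, 0) (Finset.range (α 1 - 1) ×ˢ
    insert (α 2 - 1, 0) (Finset.range (α 2 - 1) ×ˢ Finset.range (α 3)))

theorem mem_normalExponents {α : Fin 4 → ℕ} {m : ℕ × ℕ × ℕ} :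
    m ∈ normalExponents α ↔ (m.1 = α 1 - 1 ∧ m.2.1 = 0 ∧ m.2.2 = 0) ∨
      (m.1 < α 1 - 1 ∧ ((m.2.1 = α 2 - 1 ∧ m.2.2 = 0) ∨ (m.2.1 < α 2 - 1 ∧ m.2.2 < α 3))) := by
  simp [normalExponents, Prod.ext_iff]

theorem card_normalExponents {α : Fin 4 → ℕ} (hα : ∀ i, 2 ≤ α i) :
    (normalExponents α).card = (α 1 - 1) * (α 2 - 1) * α 3 + α 1 := by
  rw [normalExponents, Finset.card_insert_of_notMem (by simp), Finset.card_product,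
    Finset.card_insert_of_notMem (by simp), Finset.card_product]
  simp only [Finset.card_range]
  have := hα 1
  rw [mul_add, mul_one, mul_assoc]
  omega

/-- The relations between powers of the variables defined by the six binomials. -/
structure SatisfiesBinomials {R : Type*} [CommRing R] (α : Fin 4 → ℕ) (x : Fin 4 → R) : Prop where
  eq₁ : x 0 ^ α 0 = x 1 ^ (α 1 - 1) * x 3
  eq₂ : x 1 ^ α 1 = x 2 ^ (α 2 - 1) * x 0
  eq₃ : x 2 ^ α 2 = x 3 ^ (α 3 - 1) * x 1
  eq₄ : x 3 ^ α 3 = x 0 ^ (α 0 - 1) * x 2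
  eq₅ : x 0 ^ (α 0 - 1) * x 1 = x 2 ^ (α 2 - 1) * x 3
  eq₆ : x 0 * x 3 ^ (α 3 - 1) = x 1 ^ (α 1 - 1) * x 2

/-- The weights `n` are compatible with the six binomials, with common difference `p`. -/
structure IsCyclicWeight (n α : Fin 4 → ℕ) (p : ℕ) : Prop where
  pos : ∀ i, 0 < n i
  two_le : ∀ i, 2 ≤ α i
  eq : ∀ i, (α (i + 1) - 1) * n (i + 1) = p + n i

namespace IsCyclicWeight

variable {n α : Fin 4 → ℕ} {p : ℕ}

theorem eq' (h : IsCyclicWeight n α p) (i : Fin 4) : α (i + 1) * n (i + 1) = p + n i + n (i + 1) := by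
  rw [← h.eq i]
  obtain ⟨a, ha⟩ := Nat.exists_eq_add_of_le (h.two_le (i + 1))
  rw [ha, show 2 + a - 1 = a + 1 by omega]
  ring

/-- Every monomial is congruent to a power of `x 0` times a normal monomial of the same weight. -/
theorem exists_normal (h : IsCyclicWeight n α p) {R : Type*} [CommRing R] {x : Fin 4 → R}
    (hx : SatisfiesBinomials α x) (a b c : ℕ) :
    ∃ e : ℕ, ∃ m ∈ normalExponents α, x 1 ^ a * x 2 ^ b * x 3 ^ c =
      x 0 ^ e * (x 1 ^ m.1 * x 2 ^ m.2.1 * x 3 ^ m.2.2) ∧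
      a * n 1 + b * n 2 + c * n 3 = e * n 0 + (m.1 * n 1 + m.2.1 * n 2 + m.2.2 * n 3) := by
  have p0 := h.pos 0
  have t0 := h.two_le 0
  have t1 := h.two_le 1
  have t2 := h.two_le 2
  have t3 := h.two_le 3
  have e1 : (α 1 - 1) * n 1 = p + n 0 := h.eq 0
  have e2 : (α 2 - 1) * n 2 = p + n 1 := h.eq 1
  have e3 : (α 3 - 1) * n 3 = p + n 2 := h.eq 2
  have e0 : (α 0 - 1) * n 0 = p + n 3 := h.eq 3
  have f1 : α 1 * n 1 = p + n 0 + n 1 := h.eq' 0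
  have f2 : α 2 * n 2 = p + n 1 + n 2 := h.eq' 1
  have f3 : α 3 * n 3 = p + n 2 + n 3 := h.eq' 2
  have f0 : α 0 * n 0 = p + n 3 + n 0 := h.eq' 3
  -- Lexicographic induction on the weight, then on the exponent of `x 2`. All reductions split off
  -- a positive power of `x 0` and lower the remaining weight, except that of `x 2 ^ α 2`, which
  -- lowers the exponent of `x 2`.
  induction hW : a * n 1 + b * n 2 + c * n 3 using Nat.strong_induction_on
    generalizing a b c with
  | _ W ih =>
  induction b using Nat.strong_induction_on generalizing a c with
  | _ b ihb =>
  -- a reduction step to exponents `(a', b', c')` and an additional factor `x 0 ^ e'`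
  have step : ∀ a' b' c' e' : ℕ,
      x 1 ^ a * x 2 ^ b * x 3 ^ c = x 0 ^ e' * (x 1 ^ a' * x 2 ^ b' * x 3 ^ c') →
      a * n 1 + b * n 2 + c * n 3 = e' * n 0 + (a' * n 1 + b' * n 2 + c' * n 3) →
      (0 < e' ∨ b' < b) →
      ∃ e : ℕ, ∃ m ∈ normalExponents α, x 1 ^ a * x 2 ^ b * x 3 ^ c =
        x 0 ^ e * (x 1 ^ m.1 * x 2 ^ m.2.1 * x 3 ^ m.2.2) ∧
        W = e * n 0 + (m.1 * n 1 + m.2.1 * n 2 + m.2.2 * n 3) := by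
    intro a' b' c' e' hxe hwe hlt
    have key : ∃ e : ℕ, ∃ m ∈ normalExponents α, x 1 ^ a' * x 2 ^ b' * x 3 ^ c' =
        x 0 ^ e * (x 1 ^ m.1 * x 2 ^ m.2.1 * x 3 ^ m.2.2) ∧
        a' * n 1 + b' * n 2 + c' * n 3 =
          e * n 0 + (m.1 * n 1 + m.2.1 * n 2 + m.2.2 * n 3) := by
      by_cases he : 0 < e'
      · have : 0 < e' * n 0 := by positivity
        exact ih _ (by omega) a' b' c' rfl
      · have he0 : e' = 0 := by omega
        subst he0
        obtain ⟨e, m, hm, h1, h2⟩ := ihb b' (by omega) a' c' (by omega)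
        exact ⟨e, m, hm, h1, by omega⟩
    obtain ⟨e, m, hm, h1, h2⟩ := key
    refine ⟨e' + e, m, hm, ?_, ?_⟩
    · rw [hxe, h1, pow_add]; ring
    · rw [← hW, hwe, h2]; ring
  by_cases c1 : α 1 ≤ a
  · obtain ⟨a, rfl⟩ := Nat.exists_eq_add_of_le c1
    refine step a (b + (α 2 - 1)) c 1 ?_ ?_ (by omega)
    · rw [pow_add, hx.eq₂, pow_add]; ring
    · simp only [add_mul]; linarith
  by_cases c2 : α 2 ≤ b
  · obtain ⟨b, rfl⟩ := Nat.exists_eq_add_of_le c2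
    refine step (a + 1) b (c + (α 3 - 1)) 0 ?_ ?_ (by omega)
    · rw [pow_add, hx.eq₃, pow_add, pow_add]; ring
    · simp only [add_mul]; linarith
  by_cases c3 : α 3 ≤ c
  · obtain ⟨c, rfl⟩ := Nat.exists_eq_add_of_le c3
    refine step a (b + 1) c (α 0 - 1) ?_ ?_ (by omega)
    · rw [pow_add, hx.eq₄, pow_add]; ring
    · simp only [add_mul]; linarith
  by_cases c4 : α 1 - 1 ≤ a ∧ 1 ≤ c
  · obtain ⟨a, rfl⟩ := Nat.exists_eq_add_of_le c4.1
    obtain ⟨c, rfl⟩ := Nat.exists_eq_add_of_le c4.2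
    refine step a b c (α 0) ?_ ?_ (by omega)
    · rw [hx.eq₁, pow_add, pow_add]; ring
    · simp only [add_mul]; linarith
  by_cases c5 : α 1 - 1 ≤ a ∧ 1 ≤ b
  · obtain ⟨a, rfl⟩ := Nat.exists_eq_add_of_le c5.1
    obtain ⟨b, rfl⟩ := Nat.exists_eq_add_of_le c5.2
    refine step a b (c + (α 3 - 1)) 1 ?_ ?_ (by omega)
    · rw [pow_add, pow_add, pow_add]
      linear_combination -(x 1 ^ a * x 2 ^ b * x 3 ^ c) * hx.eq₆
    · simp only [add_mul]; linarith
  by_cases c6 : α 2 - 1 ≤ b ∧ 1 ≤ c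
  · obtain ⟨b, rfl⟩ := Nat.exists_eq_add_of_le c6.1
    obtain ⟨c, rfl⟩ := Nat.exists_eq_add_of_le c6.2
    refine step (a + 1) b c (α 0 - 1) ?_ ?_ (by omega)
    · rw [pow_add, pow_add, pow_add]
      linear_combination -(x 1 ^ a * x 2 ^ b * x 3 ^ c) * hx.eq₅
    · simp only [add_mul]; linarith
  · exact ⟨0, (a, b, c), mem_normalExponents.2 (by simp only; omega), by simp, by simp [hW]⟩

end IsCyclicWeight

namespace FrobeniusPair

variable {n α : Fin 4 → ℕ} {p q : ℤ}

theorem isCyclicWeight (h : FrobeniusPair n α p q)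
    (hp : ∀ i, p + n i = (α (i + 1) - 1 : ℤ) * n (i + 1)) :
    0 ≤ p ∧ IsCyclicWeight n α p.toNat := by
  have hp0 : 0 ≤ p := by
    by_contra hneg
    -- For `p < 0` the generators would decrease strictly all the way around the cycle.
    have key : ∀ i, (n (i + 1) : ℤ) < n i := fun i => by
      have h1 := hp i
      have h2 := h.two_le (i + 1)
      have h3 := h.pos (i + 1)
      nlinarith
    have k0 : (n 1 : ℤ) < n 0 := key 0
    have k1 : (n 2 : ℤ) < n 1 := key 1
    have k2 : (n 3 : ℤ) < n 2 := key 2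
    have k3 : (n 0 : ℤ) < n 3 := key 3
    omega
  refine ⟨hp0, fun i => by exact_mod_cast h.pos i, fun i => by exact_mod_cast h.two_le i,
    fun i => ?_⟩
  have h2 : 2 ≤ α (i + 1) := by exact_mod_cast h.two_le (i + 1)
  zify
  rw [Int.toNat_of_nonneg hp0, Nat.cast_sub (by omega), hp i]
  simp

/-- Unless all signs agree, one term stands alone against the other two, and its coefficient is too
small by the minimality of its `α i`. -/
theorem eq_zero_of_sum_eq_zero (h : FrobeniusPair n α p q) {d₁ d₂ d₃ : ℤ}
    (h1 : |d₁| < α 1) (h2 : |d₂| < α 2) (h3 : |d₃| < α 3)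
    (hs : d₁ * n 1 + d₂ * n 2 + d₃ * n 3 = 0) : d₁ = 0 ∧ d₂ = 0 ∧ d₃ = 0 := by
  rw [abs_lt] at h1 h2 h3
  have key : ∀ i j k, IsLabelling i j k 0 → ∀ a b c : ℤ, a < α i → 0 ≤ b → 0 ≤ c →
      a * n i = b * n j + c * n k → a ≤ 0 := by
    intro i j k hl a b c ha hb hc he
    by_contra hpos
    have := h.le_of_eq hl (a := a) (by omega) hb hc le_rfl (by linarith)
    omega
  have n1 := h.pos 1
  have n2 := h.pos 2
  have n3 := h.pos 3
  have zero : ∀ a b c : ℤ, a * n 1 + b * n 2 + c * n 3 = 0 → 0 ≤ a → 0 ≤ b → 0 ≤ c →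
      a = 0 ∧ b = 0 ∧ c = 0 := by
    intro a b c he ha hb hc
    have h4 := mul_nonneg ha n1.le
    have h5 := mul_nonneg hb n2.le
    have h6 := mul_nonneg hc n3.le
    exact ⟨(mul_eq_zero.1 (by linarith : a * (n 1 : ℤ) = 0)).resolve_right n1.ne',
      (mul_eq_zero.1 (by linarith : b * (n 2 : ℤ) = 0)).resolve_right n2.ne',
      (mul_eq_zero.1 (by linarith : c * (n 3 : ℤ) = 0)).resolve_right n3.ne'⟩
  have zero' : d₁ ≤ 0 → d₂ ≤ 0 → d₃ ≤ 0 → d₁ = 0 ∧ d₂ = 0 ∧ d₃ = 0 := by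
    intro a1 a2 a3
    have := zero (-d₁) (-d₂) (-d₃) (by linarith) (by omega) (by omega) (by omega)
    omega
  have zero := zero d₁ d₂ d₃ hs
  rcases le_total 0 d₁ with a1 | a1 <;> rcases le_total 0 d₂ with a2 | a2 <;>
    rcases le_total 0 d₃ with a3 | a3
  · exact zero a1 a2 a3
  · have := key 3 1 2 (by decide) (-d₃) d₁ d₂ (by omega) a1 a2 (by linarith)
    exact zero a1 a2 (by omega)
  · have := key 2 1 3 (by decide) (-d₂) d₁ d₃ (by omega) a1 a3 (by linarith)
    exact zero a1 (by omega) a3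
  · have := key 1 2 3 (by decide) d₁ (-d₂) (-d₃) (by omega) (by omega) (by omega) (by linarith)
    exact zero' this a2 a3
  · have := key 1 2 3 (by decide) (-d₁) d₂ d₃ (by omega) (by omega) (by omega) (by linarith)
    exact zero (by omega) a2 a3
  · have := key 2 1 3 (by decide) d₂ (-d₁) (-d₃) (by omega) (by omega) (by omega) (by linarith)
    exact zero' a1 this a3
  · have := key 3 1 2 (by decide) d₃ (-d₁) (-d₂) (by omega) (by omega) (by omega) (by linarith)
    exact zero' a1 a2 this
  · exact zero' a1 a2 a3

/-- The weight of a normal monomial lies in the Apéry set of `n 0`. -/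
theorem sub_notMem_of_normal (h : FrobeniusPair n α p q)
    (hp : ∀ i, p + n i = (α (i + 1) - 1 : ℤ) * n (i + 1)) (hq : q = 2 * p) {m : ℕ × ℕ × ℕ}
    (hm : m ∈ normalExponents α) :
    ¬ IsNatComb n ((m.1 * n 1 + m.2.1 * n 2 + m.2.2 * n 3 : ℤ) - n 0) := by
  have e1 : p + n 0 = (α 1 - 1 : ℤ) * n 1 := hp 0
  have e2 : p + n 1 = (α 2 - 1 : ℤ) * n 2 := hp 1
  have e3 : p + n 2 = (α 3 - 1 : ℤ) * n 3 := hp 2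
  have t1 := h.two_le 1
  have t2 := h.two_le 2
  have t3 := h.two_le 3
  intro hc
  -- Each normal monomial divides `x1^(α1-1)`, `x1^(α1-2) x2^(α2-1)` or `x1^(α1-2) x2^(α2-2)
  -- x3^(α3-1)`. These have weights `n 0` plus `p`, `2p = q` and `3p = p + q`.
  rcases mem_normalExponents.1 hm with ⟨h1, h2, h3⟩ | ⟨h1, ⟨h2, h3⟩ | ⟨h2, h3⟩⟩
  · refine h.left_notMem ?_
    have h1' : (m.1 : ℤ) = α 1 - 1 := by omega
    rw [h1', h2, h3] at hc
    rwa [show p = (α 1 - 1 : ℤ) * n 1 + (0 : ℕ) * n 2 + (0 : ℕ) * n 3 - n 0 by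
      push_cast; linarith]
  · refine h.right_notMem ?_
    have h2' : (m.2.1 : ℤ) = α 2 - 1 := by omega
    rw [show q = (m.1 * n 1 + m.2.1 * n 2 + m.2.2 * n 3 : ℤ) - n 0 + (α 1 - 2 - m.1) * n 1 by
      rw [h2', h3, hq]; push_cast; linarith]
    exact hc.add (IsNatComb.mul (by omega) 1)
  · refine h.add_notMem ?_
    rw [show p + q = (m.1 * n 1 + m.2.1 * n 2 + m.2.2 * n 3 : ℤ) - n 0 + (α 1 - 2 - m.1) * n 1 +
      (α 2 - 2 - m.2.1) * n 2 + (α 3 - 1 - m.2.2) * n 3 by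
      rw [hq]; linarith]
    exact ((hc.add (IsNatComb.mul (by omega) 1)).add (IsNatComb.mul (by omega) 2)).add
      (IsNatComb.mul (by omega) 3)

/-- The weight of the product of a power of `x 0` and a normal monomial determines both. -/
theorem normal_injective (h : FrobeniusPair n α p q)
    (hp : ∀ i, p + n i = (α (i + 1) - 1 : ℤ) * n (i + 1)) (hq : q = 2 * p) {e e' : ℕ}
    {m m' : ℕ × ℕ × ℕ} (hm : m ∈ normalExponents α) (hm' : m' ∈ normalExponents α)
    (he : e * n 0 + (m.1 * n 1 + m.2.1 * n 2 + m.2.2 * n 3) =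
      e' * n 0 + (m'.1 * n 1 + m'.2.1 * n 2 + m'.2.2 * n 3)) : e = e' ∧ m = m' := by
  have key : ∀ {e e' : ℕ} {m m' : ℕ × ℕ × ℕ}, m ∈ normalExponents α →
      e * n 0 + (m.1 * n 1 + m.2.1 * n 2 + m.2.2 * n 3) =
      e' * n 0 + (m'.1 * n 1 + m'.2.1 * n 2 + m'.2.2 * n 3) → ¬ e < e' := by
    intro e e' m m' hm he hlt
    refine h.sub_notMem_of_normal hp hq hm (IsNatComb.of_eq (i := 0) (j := 1) (k := 2) (l := 3)
      (a := e' - e - 1) (b := m'.1) (c := m'.2.1) (d := m'.2.2) (by omega) (by omega) (by omega)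
      (by omega) ?_)
    zify at he
    linarith
  have hee : e = e' := le_antisymm (not_lt.1 (key hm' he.symm)) (not_lt.1 (key hm he))
  refine ⟨hee, ?_⟩
  subst hee
  have t1 := h.two_le 1
  have t2 := h.two_le 2
  have t3 := h.two_le 3
  have hb : ∀ {m : ℕ × ℕ × ℕ}, m ∈ normalExponents α → m.1 < α 1 ∧ m.2.1 < α 2 ∧ m.2.2 < α 3 := by
    intro m hm
    have := mem_normalExponents.1 hm
    omega
  obtain ⟨a1, a2, a3⟩ := hb hm
  obtain ⟨b1, b2, b3⟩ := hb hm'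
  obtain ⟨h1, h2, h3⟩ := h.eq_zero_of_sum_eq_zero (d₁ := m.1 - m'.1) (d₂ := m.2.1 - m'.2.1)
    (d₃ := m.2.2 - m'.2.2) (by rw [abs_lt]; omega) (by rw [abs_lt]; omega) (by rw [abs_lt]; omega)
    (by zify at he; linarith)
  ext <;> omega

/-- The weights of the normal monomials represent each residue class modulo `n 0` exactly once. -/
theorem gen_zero_eq (h : FrobeniusPair n α p q)
    (hp : ∀ i, p + n i = (α (i + 1) - 1 : ℤ) * n (i + 1)) (hq : q = 2 * p)
    (hcof : ∃ N : ℕ, ∀ a : ℕ, N ≤ a → IsNatComb n a) :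
    n 0 = (α 1 - 1) * (α 2 - 1) * α 3 + α 1 := by
  have hw := (h.isCyclicWeight hp).2
  rw [← card_normalExponents hw.two_le]
  conv_lhs => rw [← Finset.card_range (n 0)]
  symm
  refine Finset.card_nbij (fun m => (m.1 * n 1 + m.2.1 * n 2 + m.2.2 * n 3) % n 0) ?_ ?_ ?_
  · intro m _
    simpa using Nat.mod_lt _ (hw.pos 0)
  · intro m hm m' hm' hmm
    simp only at hmm
    have h1 := Nat.div_add_mod (m.1 * n 1 + m.2.1 * n 2 + m.2.2 * n 3) (n 0)
    have h2 := Nat.div_add_mod (m'.1 * n 1 + m'.2.1 * n 2 + m'.2.2 * n 3) (n 0)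
    -- The quotients are exchanged: equal remainders make the total weights agree.
    refine (h.normal_injective hp hq (e := (m'.1 * n 1 + m'.2.1 * n 2 + m'.2.2 * n 3) / n 0)
      (e' := (m.1 * n 1 + m.2.1 * n 2 + m.2.2 * n 3) / n 0) hm hm' ?_).2
    rw [hmm] at h1
    linarith
  · intro r hr
    obtain ⟨N, hN⟩ := hcof
    have hr' : r < n 0 := by simpa using hr
    obtain ⟨c, hc⟩ := hN (N * n 0 + r) (by nlinarith [hw.pos 0])
    have hc' : N * n 0 + r = c 0 * n 0 + (c 1 * n 1 + c 2 * n 2 + c 3 * n 3) := by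
      rw [Fin.sum_univ_four] at hc
      zify
      push_cast at hc
      linarith
    -- Only the equation of weights is needed, so all variables are set to 1.
    obtain ⟨e, m, hm, -, hme⟩ := hw.exists_normal (R := ℤ) (x := fun _ => 1)
      ⟨by simp, by simp, by simp, by simp, by simp, by simp⟩ (c 1) (c 2) (c 3)
    refine ⟨m, hm, ?_⟩
    rw [hme] at hc'
    have h1 := congrArg (· % n 0) hc'
    simp only [Nat.mul_add_mod_self_right] at h1
    rw [Nat.mod_eq_of_lt hr'] at h1
    simp only
    rw [h1]

/-- The generators are determined by the `α i`. -/
theorem gen_eq (h : FrobeniusPair n α p q)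
    (hp : ∀ i, p + n i = (α (i + 1) - 1 : ℤ) * n (i + 1)) (hq : q = 2 * p)
    (hcof : ∃ N : ℕ, ∀ a : ℕ, N ≤ a → IsNatComb n a) (i : Fin 4) :
    n i = (α (i + 1) - 1) * (α (i + 2) - 1) * α (i + 3) + α (i + 1) := by
  have hcomp := (h.comp (Equiv.addLeft i)).gen_zero_eq (fun j => ?_) hq ?_
  · simpa using hcomp
  · have := hp (i + j)
    simpa [add_assoc] using this
  · obtain ⟨N, hN⟩ := hcof
    refine ⟨N, fun a ha => ?_⟩
    obtain ⟨c, hc⟩ := hN a ha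
    refine ⟨c ∘ Equiv.addLeft i, hc.trans ?_⟩
    rw [← Equiv.sum_comp (Equiv.addLeft i)]
    rfl

end FrobeniusPair

/-! ### The defining ideal -/

section DefiningIdeal

variable {n α : Fin 4 → ℕ} {p : ℕ}

theorem SatisfiesBinomials.of_isCyclicWeight (h : IsCyclicWeight n α p) {R : Type*} [CommRing R]
    (t : R) : SatisfiesBinomials α (fun i => t ^ n i) := by
  have e1 : (α 1 - 1) * n 1 = p + n 0 := h.eq 0
  have e2 : (α 2 - 1) * n 2 = p + n 1 := h.eq 1
  have e3 : (α 3 - 1) * n 3 = p + n 2 := h.eq 2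
  have e0 : (α 0 - 1) * n 0 = p + n 3 := h.eq 3
  have f1 : α 1 * n 1 = p + n 0 + n 1 := h.eq' 0
  have f2 : α 2 * n 2 = p + n 1 + n 2 := h.eq' 1
  have f3 : α 3 * n 3 = p + n 2 + n 3 := h.eq' 2
  have f0 : α 0 * n 0 = p + n 3 + n 0 := h.eq' 3
  constructor <;>
  · simp only [← pow_mul, ← pow_add]
    congr 1
    linarith

theorem satisfiesBinomials_iff {R : Type*} [CommRing R] {k : Type*} [Field k] [Algebra k R]
    {x : Fin 4 → R} : SatisfiesBinomials α x ↔ ∀ i, aeval x (sixBinomials k α i) = 0 := by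
  constructor
  · intro h i
    obtain ⟨h1, h2, h3, h4, h5, h6⟩ := h
    fin_cases i <;> simp [sixBinomials, *]
  · intro h
    have h0 := h 0
    have h1 := h 1
    have h2 := h 2
    have h3 := h 3
    have h4 := h 4
    have h5 := h 5
    simp only [sixBinomials, Matrix.cons_val, map_sub, map_mul, map_pow, aeval_X, sub_eq_zero]
      at h0 h1 h2 h3 h4 h5
    exact ⟨h0, h1, h2, h3, h4, h5⟩

theorem span_sixBinomials_le (h : IsCyclicWeight n α p) (k : Type*) [Field k] :
    Ideal.span (Set.range (sixBinomials k α)) ≤ definingIdeal k n := by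
  rw [Ideal.span_le]
  rintro _ ⟨i, rfl⟩
  exact satisfiesBinomials_iff.1 (SatisfiesBinomials.of_isCyclicWeight h Polynomial.X) i

theorem satisfiesBinomials_mk (k : Type*) [Field k] (α : Fin 4 → ℕ) :
    SatisfiesBinomials α
      (fun i => Ideal.Quotient.mk (Ideal.span (Set.range (sixBinomials k α))) (X i)) := by
  rw [satisfiesBinomials_iff (k := k)]
  intro i
  have : (aeval fun i => Ideal.Quotient.mk (Ideal.span (Set.range (sixBinomials k α))) (X i)) =
      Ideal.Quotient.mkₐ k (Ideal.span (Set.range (sixBinomials k α))) := by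
    ext i
    simp
  rw [this, Ideal.Quotient.mkₐ_eq_mk, Ideal.Quotient.eq_zero_iff_mem]
  exact Ideal.subset_span ⟨i, rfl⟩

/-- The product of a power of `X 0` and a normal monomial. -/
noncomputable def normalMonomial (k : Type*) [Field k] (α : Fin 4 → ℕ)
    (m : ℕ × normalExponents α) : MvPolynomial (Fin 4) k :=
  X 0 ^ m.1 * (X 1 ^ m.2.1.1 * X 2 ^ m.2.1.2.1 * X 3 ^ m.2.1.2.2)

theorem span_normalMonomial_sup (h : IsCyclicWeight n α p) (k : Type*) [Field k] :
    Submodule.span k (Set.range (normalMonomial k α)) ⊔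
      (Ideal.span (Set.range (sixBinomials k α))).restrictScalars k = ⊤ := by
  rw [eq_top_iff]
  intro g _
  rw [← support_sum_monomial_coeff g]
  refine Submodule.sum_mem _ fun d _ => ?_
  rw [← mul_one (coeff d g), ← smul_eq_mul, ← smul_monomial]
  refine Submodule.smul_mem _ _ ?_
  rw [monomial_eq, Finsupp.prod_fintype _ _ (fun i => pow_zero _), Fin.prod_univ_four, map_one,
    one_mul]
  obtain ⟨e, m, hm, he, -⟩ := h.exists_normal (satisfiesBinomials_mk k α) (d 1) (d 2) (d 3)
  simp only [← map_pow, ← map_mul] at he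
  rw [Ideal.Quotient.eq] at he
  have hb : normalMonomial k α (d 0 + e, ⟨m, hm⟩) ∈
      Submodule.span k (Set.range (normalMonomial k α)) := Submodule.subset_span ⟨_, rfl⟩
  refine Submodule.mem_sup.2 ⟨_, hb, _,
    Submodule.restrictScalars_mem k _ _ |>.2 (Ideal.mul_mem_left _ (X 0 ^ d 0) he), ?_⟩
  simp only [normalMonomial, pow_add]
  ring

/-- Modulo the binomials, an element of the kernel is a combination of normal monomials times powers
of `X 0`. These map to distinct powers of `t`, so the combination is zero. -/
theorem definingIdeal_eq_span {p q : ℤ} (h : FrobeniusPair n α p q)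
    (hp : ∀ i, p + n i = (α (i + 1) - 1 : ℤ) * n (i + 1)) (hq : q = 2 * p)
    (k : Type*) [Field k] :
    definingIdeal k n = Ideal.span (Set.range (sixBinomials k α)) := by
  have hw := (h.isCyclicWeight hp).2
  refine le_antisymm (fun g hg => ?_) (span_sixBinomials_le hw k)
  have hg' : g ∈ Submodule.span k (Set.range (normalMonomial k α)) ⊔
      (Ideal.span (Set.range (sixBinomials k α))).restrictScalars k := by
    rw [span_normalMonomial_sup hw]
    trivial
  obtain ⟨u, hu, v, hv, rfl⟩ := Submodule.mem_sup.1 hg'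
  obtain ⟨c, rfl⟩ := (Finsupp.mem_span_range_iff_exists_finsupp).1 hu
  have hv' := span_sixBinomials_le hw k hv
  have hcu := (Submodule.add_mem_iff_left _ hv').1 hg
  set φ : MvPolynomial (Fin 4) k →ₐ[k] Polynomial k :=
    aeval (fun i => (Polynomial.X : Polynomial k) ^ n i) with hφ
  let deg : ℕ × normalExponents α → ℕ := fun m =>
    m.1 * n 0 + (m.2.1.1 * n 1 + m.2.1.2.1 * n 2 + m.2.1.2.2 * n 3)
  have hdeg : Function.Injective deg := by
    rintro ⟨e, m, hm⟩ ⟨e', m', hm'⟩ he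
    obtain ⟨rfl, rfl⟩ := h.normal_injective hp hq hm hm' he
    rfl
  have hφb : ∀ m, φ (normalMonomial k α m) = Polynomial.basisMonomials k (deg m) := by
    intro m
    simp only [hφ, normalMonomial, map_mul, map_pow, aeval_X, Polynomial.coe_basisMonomials,
      ← pow_mul, ← pow_add, Polynomial.monomial_one_right_eq_X_pow, deg]
    congr 1
    ring
  have hli := (Polynomial.basisMonomials k).linearIndependent.comp deg hdeg
  rw [linearIndependent_iff] at hli
  have hc : c = 0 := by
    refine hli c ?_
    have hcu' : φ (c.sum fun i a => a • normalMonomial k α i) = 0 := hcu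
    rw [Finsupp.linearCombination_apply]
    rw [map_finsuppSum] at hcu'
    simpa [hφb] using hcu'
  rw [hc]
  simpa using hv

end DefiningIdeal

/-! ### The Eagon-Northcott complex of a matrix with two rows and four columns -/

section EagonNorthcott

variable {R : Type*} [CommRing R] (a x : Fin 4 → R)

/-- The maximal minors of the matrix with rows `a 0, a 1, a 2, a 3` and `x 3, x 0, x 1, x 2`. -/
def columnMinors : Fin 6 → R :=
  ![a 0 * x 0 - a 1 * x 3, a 1 * x 1 - a 2 * x 0, a 2 * x 2 - a 3 * x 1, a 3 * x 3 - a 0 * x 2,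
    a 0 * x 1 - a 2 * x 3, a 1 * x 2 - a 3 * x 0]

def firstMatrix : Matrix (Fin 1) (Fin 6) R :=
  !![columnMinors a x 0, columnMinors a x 1, columnMinors a x 2, columnMinors a x 3,
    columnMinors a x 4, columnMinors a x 5]

/-- Each pair of columns belongs to three columns of the 2 × 4 matrix: the determinants with the row
`a`, or the row `x`, repeated are expanded along the extra row. -/
def secondMatrix : Matrix (Fin 6) (Fin 8) R :=
  !![a 2, x 1, 0, 0, 0, 0, a 3, x 2;
     a 0, x 3, 0, 0, a 3, x 2, 0, 0;
     0, 0, a 0, x 3, a 1, x 0, 0, 0;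
     0, 0, a 2, x 1, 0, 0, a 1, x 0;
     -a 1, -x 0, a 3, x 2, 0, 0, 0, 0;
     0, 0, 0, 0, -a 2, -x 1, a 0, x 3]

def thirdMatrix : Matrix (Fin 8) (Fin 3) R :=
  Matrix.transpose
  !![0, x 2, 0, x 0, 0, -x 3, 0, -x 1;
     a 3, 0, a 1, 0, -a 0, 0, -a 2, 0;
     -x 2, -a 3, -x 0, -a 1, x 3, a 0, x 1, a 2]

theorem firstMatrix_mulVec (v : Fin 6 → R) : (firstMatrix a x).mulVec v =
    fun _ => columnMinors a x 0 * v 0 + columnMinors a x 1 * v 1 + columnMinors a x 2 * v 2 +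
      columnMinors a x 3 * v 3 + columnMinors a x 4 * v 4 + columnMinors a x 5 * v 5 := by
  funext j
  fin_cases j
  simp [firstMatrix, Matrix.mulVec, dotProduct, Fin.sum_univ_succ]
  ring

theorem secondMatrix_mulVec (v : Fin 8 → R) : (secondMatrix a x).mulVec v =
    ![a 2 * v 0 + x 1 * v 1 + a 3 * v 6 + x 2 * v 7,
      a 0 * v 0 + x 3 * v 1 + a 3 * v 4 + x 2 * v 5,
      a 0 * v 2 + x 3 * v 3 + a 1 * v 4 + x 0 * v 5,
      a 2 * v 2 + x 1 * v 3 + a 1 * v 6 + x 0 * v 7,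
      -a 1 * v 0 - x 0 * v 1 + a 3 * v 2 + x 2 * v 3,
      -a 2 * v 4 - x 1 * v 5 + a 0 * v 6 + x 3 * v 7] := by
  funext j
  fin_cases j <;>
  · simp [secondMatrix, Matrix.mulVec, dotProduct, Fin.sum_univ_succ]
    try ring

theorem thirdMatrix_mulVec (v : Fin 3 → R) : (thirdMatrix a x).mulVec v =
    ![a 3 * v 1 - x 2 * v 2, x 2 * v 0 - a 3 * v 2, a 1 * v 1 - x 0 * v 2, x 0 * v 0 - a 1 * v 2,
      x 3 * v 2 - a 0 * v 1, a 0 * v 2 - x 3 * v 0, x 1 * v 2 - a 2 * v 1,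
      a 2 * v 2 - x 1 * v 0] := by
  funext j
  fin_cases j <;>
  · simp [thirdMatrix, Matrix.mulVec, dotProduct, Fin.sum_univ_succ]
    try ring

theorem firstMatrix_mulVec_secondMatrix (v : Fin 8 → R) :
    (firstMatrix a x).mulVec ((secondMatrix a x).mulVec v) = 0 := by
  rw [firstMatrix_mulVec, secondMatrix_mulVec]
  funext j
  simp [columnMinors]
  ring

theorem secondMatrix_mulVec_thirdMatrix (v : Fin 3 → R) :
    (secondMatrix a x).mulVec ((thirdMatrix a x).mulVec v) = 0 := by
  rw [secondMatrix_mulVec, thirdMatrix_mulVec]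
  funext j
  fin_cases j <;>
  · simp
    ring

variable {a x}

/-- Multiplication by a maximal minor is null-homotopic on the complex, and the witnesses are the
homotopies. The cycle condition enters only in coordinate `i`. -/
theorem exists_secondMatrix_of_minor {v : Fin 6 → R} (hv : (firstMatrix a x).mulVec v = 0)
    (i : Fin 6) : ∃ u, (secondMatrix a x).mulVec u = columnMinors a x i • v := by
  have h := congrFun hv 0
  rw [firstMatrix_mulVec] at h
  simp [columnMinors] at h
  fin_cases i
  · refine ⟨![x 0 * v 1 - x 2 * v 2 + x 3 * v 4, -a 1 * v 1 - a 0 * v 4, 0, -a 1 * v 2, 0,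
      a 0 * v 2, x 1 * v 2 - x 3 * v 3 + x 0 * v 5, a 0 * v 3 - a 1 * v 5], ?_⟩
    rw [secondMatrix_mulVec]
    funext j
    fin_cases j
    · simp [columnMinors]; linear_combination -h
    · simp [columnMinors]; ring
    · simp [columnMinors]; ring
    · simp [columnMinors]; ring
    · simp [columnMinors]; ring
    · simp [columnMinors]; ring
  · refine ⟨![-x 0 * v 0 - x 1 * v 4, a 1 * v 0 - a 3 * v 3 + a 2 * v 4, -x 0 * v 3, 0,
      x 1 * v 2 + x 0 * v 5, -a 2 * v 2 + a 0 * v 3 - a 1 * v 5, x 1 * v 3, 0], ?_⟩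
    rw [secondMatrix_mulVec]
    funext j
    fin_cases j
    · simp [columnMinors]; ring
    · simp [columnMinors]; linear_combination -h
    · simp [columnMinors]; ring
    · simp [columnMinors]; ring
    · simp [columnMinors]; ring
    · simp [columnMinors]; ring
  · refine ⟨![x 2 * v 0, 0, x 2 * v 3 - x 1 * v 4, a 1 * v 0 - a 3 * v 3 + a 2 * v 4,
      -x 1 * v 1 - x 2 * v 5, -a 0 * v 0 + a 2 * v 1 + a 3 * v 5, -x 1 * v 0, 0], ?_⟩
    rw [secondMatrix_mulVec]
    funext j
    fin_cases j
    · simp [columnMinors]; ring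
    · simp [columnMinors]; ring
    · simp [columnMinors]; linear_combination -h
    · simp [columnMinors]; ring
    · simp [columnMinors]; ring
    · simp [columnMinors]; ring
  · refine ⟨![0, a 3 * v 1, x 0 * v 1 - x 2 * v 2 + x 3 * v 4, a 3 * v 2 - a 0 * v 4, 0,
      -a 0 * v 1, x 3 * v 0 - x 1 * v 1 - x 2 * v 5, -a 0 * v 0 + a 3 * v 5], ?_⟩
    rw [secondMatrix_mulVec]
    funext j
    fin_cases j
    · simp [columnMinors]; ring
    · simp [columnMinors]; ring
    · simp [columnMinors]; ring
    · simp [columnMinors]; linear_combination -h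
    · simp [columnMinors]; ring
    · simp [columnMinors]; ring
  · refine ⟨![-x 3 * v 0 + x 1 * v 1, a 0 * v 0 - a 2 * v 1 - a 3 * v 5, x 1 * v 2 - x 3 * v 3,
      -a 2 * v 2 + a 0 * v 3 - a 1 * v 5, x 3 * v 5, 0, x 1 * v 5, 0], ?_⟩
    rw [secondMatrix_mulVec]
    funext j
    fin_cases j
    · simp [columnMinors]; ring
    · simp [columnMinors]; ring
    · simp [columnMinors]; ring
    · simp [columnMinors]; ring
    · simp [columnMinors]; linear_combination -h
    · simp [columnMinors]; ring
  · refine ⟨![0, a 3 * v 4, 0, a 1 * v 4, -x 0 * v 1 + x 2 * v 2 - x 3 * v 4,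
      a 1 * v 1 - a 3 * v 2, -x 0 * v 0 + x 2 * v 3 - x 1 * v 4, a 1 * v 0 - a 3 * v 3], ?_⟩
    rw [secondMatrix_mulVec]
    funext j
    fin_cases j
    · simp [columnMinors]; ring
    · simp [columnMinors]; ring
    · simp [columnMinors]; ring
    · simp [columnMinors]; ring
    · simp [columnMinors]; ring
    · simp [columnMinors]; linear_combination -h

theorem exists_thirdMatrix_of_minor {v : Fin 8 → R} (hv : (secondMatrix a x).mulVec v = 0)
    (i : Fin 6) : ∃ u, (thirdMatrix a x).mulVec u = columnMinors a x i • v := by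
  rw [secondMatrix_mulVec] at hv
  have h0 := congrFun hv 0
  have h1 := congrFun hv 1
  have h2 := congrFun hv 2
  have h3 := congrFun hv 3
  have h4 := congrFun hv 4
  have h5 := congrFun hv 5
  simp at h0 h1 h2 h3 h4 h5
  fin_cases i
  · refine ⟨![a 0 * v 3 + a 1 * v 5, -x 3 * v 2 - x 0 * v 4, -a 0 * v 2 - a 1 * v 4], ?_⟩
    rw [thirdMatrix_mulVec]
    funext j
    fin_cases j
    · simp [columnMinors]; linear_combination -x 0 * h1 + x 2 * h2 - x 3 * h4
    · simp [columnMinors]; linear_combination a 1 * h1 + a 0 * h4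
    · simp [columnMinors]; ring
    · simp [columnMinors]; linear_combination a 1 * h2
    · simp [columnMinors]; ring
    · simp [columnMinors]; linear_combination -a 0 * h2
    · simp [columnMinors]; linear_combination -x 1 * h2 + x 3 * h3 - x 0 * h5
    · simp [columnMinors]; linear_combination -a 0 * h3 + a 1 * h5
  · refine ⟨![-a 2 * v 3 - a 1 * v 7, x 1 * v 2 + x 0 * v 6, -x 1 * v 3 - x 0 * v 7], ?_⟩
    rw [thirdMatrix_mulVec]
    funext j
    fin_cases j
    · simp [columnMinors]; linear_combination x 0 * h0 + x 1 * h4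
    · simp [columnMinors]; linear_combination -a 1 * h0 + a 3 * h3 - a 2 * h4
    · simp [columnMinors]; linear_combination x 0 * h3
    · simp [columnMinors]; ring
    · simp [columnMinors]; linear_combination -x 1 * h2 - x 0 * h5
    · simp [columnMinors]; linear_combination a 2 * h2 - a 0 * h3 + a 1 * h5
    · simp [columnMinors]; linear_combination -x 1 * h3
    · simp [columnMinors]; ring
  · refine ⟨![a 2 * v 1 + a 3 * v 7, -x 1 * v 0 - x 2 * v 6, x 1 * v 1 + x 2 * v 7], ?_⟩
    rw [thirdMatrix_mulVec]
    funext j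
    fin_cases j
    · simp [columnMinors]; linear_combination -x 2 * h0
    · simp [columnMinors]; ring
    · simp [columnMinors]; linear_combination -x 2 * h3 + x 1 * h4
    · simp [columnMinors]; linear_combination -a 1 * h0 + a 3 * h3 - a 2 * h4
    · simp [columnMinors]; linear_combination x 1 * h1 + x 2 * h5
    · simp [columnMinors]; linear_combination a 0 * h0 - a 2 * h1 - a 3 * h5
    · simp [columnMinors]; linear_combination x 1 * h0
    · simp [columnMinors]; ring
  · refine ⟨![-a 0 * v 1 - a 3 * v 5, x 3 * v 0 + x 2 * v 4, a 0 * v 0 + a 3 * v 4], ?_⟩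
    rw [thirdMatrix_mulVec]
    funext j
    fin_cases j
    · simp [columnMinors]; ring
    · simp [columnMinors]; linear_combination -a 3 * h1
    · simp [columnMinors]; linear_combination -x 0 * h1 + x 2 * h2 - x 3 * h4
    · simp [columnMinors]; linear_combination -a 3 * h2 + a 0 * h4
    · simp [columnMinors]; ring
    · simp [columnMinors]; linear_combination a 0 * h1
    · simp [columnMinors]; linear_combination -x 3 * h0 + x 1 * h1 + x 2 * h5
    · simp [columnMinors]; linear_combination a 0 * h0 - a 3 * h5
  · refine ⟨![a 2 * v 5 - a 0 * v 7, -x 1 * v 4 + x 3 * v 6, x 1 * v 5 - x 3 * v 7], ?_⟩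
    rw [thirdMatrix_mulVec]
    funext j
    fin_cases j
    · simp [columnMinors]; linear_combination x 3 * h0 - x 1 * h1
    · simp [columnMinors]; linear_combination -a 0 * h0 + a 2 * h1 + a 3 * h5
    · simp [columnMinors]; linear_combination -x 1 * h2 + x 3 * h3
    · simp [columnMinors]; linear_combination a 2 * h2 - a 0 * h3 + a 1 * h5
    · simp [columnMinors]; linear_combination -x 3 * h5
    · simp [columnMinors]; ring
    · simp [columnMinors]; linear_combination -x 1 * h5
    · simp [columnMinors]; ring
  · refine ⟨![a 1 * v 1 - a 3 * v 3, -x 0 * v 0 + x 2 * v 2, -a 1 * v 0 + a 3 * v 2], ?_⟩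
    rw [thirdMatrix_mulVec]
    funext j
    fin_cases j
    · simp [columnMinors]; ring
    · simp [columnMinors]; linear_combination -a 3 * h4
    · simp [columnMinors]; ring
    · simp [columnMinors]; linear_combination -a 1 * h4
    · simp [columnMinors]; linear_combination x 0 * h1 - x 2 * h2 + x 3 * h4
    · simp [columnMinors]; linear_combination -a 1 * h1 + a 3 * h2
    · simp [columnMinors]; linear_combination x 0 * h0 - x 2 * h3 + x 1 * h4
    · simp [columnMinors]; linear_combination -a 1 * h0 + a 3 * h3

theorem minor_smul_eq_zero {v : Fin 3 → R} (hv : (thirdMatrix a x).mulVec v = 0)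
    (i : Fin 6) : columnMinors a x i • v = 0 := by
  rw [thirdMatrix_mulVec] at hv
  have h0 := congrFun hv 0
  have h1 := congrFun hv 1
  have h2 := congrFun hv 2
  have h3 := congrFun hv 3
  have h4 := congrFun hv 4
  have h5 := congrFun hv 5
  have h6 := congrFun hv 6
  have h7 := congrFun hv 7
  simp at h0 h1 h2 h3 h4 h5 h6 h7
  suffices h : columnMinors a x i * v 0 = 0 ∧ columnMinors a x i * v 1 = 0 ∧
      columnMinors a x i * v 2 = 0 by
    obtain ⟨g0, g1, g2⟩ := h
    funext j
    fin_cases j <;> simpa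
  fin_cases i
  · refine ⟨?_, ?_, ?_⟩
    · simp [columnMinors]; linear_combination a 0 * h3 + a 1 * h5
    · simp [columnMinors]; linear_combination -x 3 * h2 - x 0 * h4
    · simp [columnMinors]; linear_combination -a 0 * h2 - a 1 * h4
  · refine ⟨?_, ?_, ?_⟩
    · simp [columnMinors]; linear_combination -a 2 * h3 - a 1 * h7
    · simp [columnMinors]; linear_combination x 1 * h2 + x 0 * h6
    · simp [columnMinors]; linear_combination -x 1 * h3 - x 0 * h7
  · refine ⟨?_, ?_, ?_⟩
    · simp [columnMinors]; linear_combination a 2 * h1 + a 3 * h7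
    · simp [columnMinors]; linear_combination -x 1 * h0 - x 2 * h6
    · simp [columnMinors]; linear_combination x 1 * h1 + x 2 * h7
  · refine ⟨?_, ?_, ?_⟩
    · simp [columnMinors]; linear_combination -a 0 * h1 - a 3 * h5
    · simp [columnMinors]; linear_combination x 3 * h0 + x 2 * h4
    · simp [columnMinors]; linear_combination a 0 * h0 + a 3 * h4
  · refine ⟨?_, ?_, ?_⟩
    · simp [columnMinors]; linear_combination a 2 * h5 - a 0 * h7
    · simp [columnMinors]; linear_combination -x 1 * h4 + x 3 * h6
    · simp [columnMinors]; linear_combination x 1 * h5 - x 3 * h7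
  · refine ⟨?_, ?_, ?_⟩
    · simp [columnMinors]; linear_combination a 1 * h1 - a 3 * h3
    · simp [columnMinors]; linear_combination -x 0 * h0 + x 2 * h2
    · simp [columnMinors]; linear_combination -a 1 * h0 + a 3 * h2

end EagonNorthcott

/-! ### Exactness -/

section Regular

/-- A monic polynomial stays monic over `B ⧸ J`, hence is not a zero divisor there. -/
theorem Polynomial.Monic.mem_map_C_of_mul_mem {B : Type*} [CommRing B] {J : Ideal B}
    {f g : Polynomial B} (hf : f.Monic) (h : f * g ∈ J.map Polynomial.C) :
    g ∈ J.map Polynomial.C := by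
  have hker : RingHom.ker (Polynomial.mapRingHom (Ideal.Quotient.mk J)) = J.map Polynomial.C := by
    rw [Polynomial.ker_mapRingHom, Ideal.mk_ker]
  rw [← hker, RingHom.mem_ker] at h ⊢
  rw [map_mul, Polynomial.coe_mapRingHom] at h
  exact ((hf.map (Ideal.Quotient.mk J)).mul_right_eq_zero_iff).1 h

variable {k : Type*} [Field k]

/-- The polynomial ring in four variables as a polynomial ring in `X i` over the polynomial ring in
the other variables. -/
noncomputable def polynomialEquiv (k : Type*) [Field k] (i : Fin 4) :
    MvPolynomial (Fin 4) k ≃ₐ[k] Polynomial (MvPolynomial (Fin 3) k) :=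
  (renameEquiv k (Equiv.swap 0 i)).trans (finSuccEquiv k 3)

theorem polynomialEquiv_X_self (i : Fin 4) : polynomialEquiv k i (X i) = Polynomial.X := by
  simp [polynomialEquiv, finSuccEquiv_X_zero]

theorem polynomialEquiv_X_of_ne {i j : Fin 4} (h : j ≠ i) :
    ∃ c, polynomialEquiv k i (X j) = Polynomial.C (X c) := by
  have hne : Equiv.swap 0 i j ≠ 0 := by
    revert i j; decide
  obtain ⟨c, hc⟩ := Fin.exists_succ_eq.2 hne
  exact ⟨c, by simp [polynomialEquiv, ← hc, finSuccEquiv_X_succ]⟩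

/-- An element monic in `X i` is a nonzerodivisor modulo polynomials free of `X i`. -/
theorem mem_span_of_mul_mem_span (i : Fin 4) {d r : MvPolynomial (Fin 4) k}
    {s : Set (MvPolynomial (Fin 4) k)} (hd : (polynomialEquiv k i d).Monic)
    (hs : ∀ g ∈ s, ∃ b, polynomialEquiv k i g = Polynomial.C b) (h : d * r ∈ Ideal.span s) :
    r ∈ Ideal.span s := by
  have himg : polynomialEquiv k i '' s =
      Polynomial.C '' {b | Polynomial.C b ∈ polynomialEquiv k i '' s} := by
    ext g
    constructor
    · rintro ⟨g, hg, rfl⟩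
      obtain ⟨b, hb⟩ := hs g hg
      exact ⟨b, ⟨g, hg, hb⟩, hb.symm⟩
    · rintro ⟨b, hb, rfl⟩
      exact hb
  have hmap : (Ideal.span s).map (polynomialEquiv k i) =
      (Ideal.span {b | Polynomial.C b ∈ polynomialEquiv k i '' s}).map Polynomial.C := by
    rw [Ideal.map_span, Ideal.map_span, ← himg]
  have h1 := Ideal.mem_map_of_mem (polynomialEquiv k i) h
  rw [map_mul, hmap] at h1
  have h2 := hd.mem_map_C_of_mul_mem h1
  rw [← hmap, Ideal.mem_map_of_equiv] at h2
  obtain ⟨r', hr', he⟩ := h2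
  rwa [← (polynomialEquiv k i).injective he]

/-- A binomial involving only the variables `X i` and `X 3`. -/
noncomputable def binomialElement (k : Type*) [Field k] (n : Fin 4 → ℕ) (i : Fin 4) :
    MvPolynomial (Fin 4) k :=
  X i ^ n 3 - X 3 ^ n i

variable {n : Fin 4 → ℕ}

theorem monic_binomialElement (hn : 0 < n 3) {i : Fin 4} (hi : i ≠ 3) :
    (polynomialEquiv k i (binomialElement k n i)).Monic := by
  obtain ⟨c, hc⟩ := polynomialEquiv_X_of_ne (k := k) hi.symm
  rw [binomialElement, map_sub, map_pow, map_pow, polynomialEquiv_X_self, hc, ← Polynomial.C_pow]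
  exact Polynomial.monic_X_pow_sub_C _ hn.ne'

theorem exists_C_binomialElement {i j : Fin 4} (hi : i ≠ 3) (hj : j ≠ i) :
    ∃ b, polynomialEquiv k i (binomialElement k n j) = Polynomial.C b := by
  obtain ⟨c, hc⟩ := polynomialEquiv_X_of_ne (k := k) hi.symm
  obtain ⟨c', hc'⟩ := polynomialEquiv_X_of_ne (k := k) hj
  exact ⟨X c' ^ n 3 - X c ^ n j, by simp [binomialElement, hc, hc']⟩

theorem binomialElement_mem (k : Type*) [Field k] (n : Fin 4 → ℕ) (i : Fin 4) :
    binomialElement k n i ∈ definingIdeal k n := by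
  change aeval _ _ = _
  simp only [binomialElement, map_sub, map_pow, aeval_X, ← pow_mul]
  rw [mul_comm, sub_self]

end Regular

/-! ### Acyclicity from a regular sequence of length three -/

/-- Three elements which form a regular sequence. -/
structure IsRegularTriple {R : Type*} [CommRing R] (d₁ d₂ d₃ : R) : Prop where
  left : ∀ r, d₁ * r = 0 → r = 0
  middle : ∀ r, d₁ ∣ d₂ * r → d₁ ∣ r
  right : ∀ r, d₃ * r ∈ Ideal.span {d₁, d₂} → r ∈ Ideal.span {d₁, d₂}

theorem isRegularTriple_binomialElement (k : Type*) [Field k] {n : Fin 4 → ℕ} (hn : 0 < n 3) :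
    IsRegularTriple (binomialElement k n 0) (binomialElement k n 1) (binomialElement k n 2) := by
  refine ⟨fun r hr => ?_, fun r hr => ?_, fun r hr => ?_⟩
  · have := mem_span_of_mul_mem_span 0 (s := ∅) (r := r) (monic_binomialElement hn (by decide))
      (by simp) (by rw [hr]; exact zero_mem _)
    simpa using this
  · rw [← Ideal.mem_span_singleton] at hr ⊢
    refine mem_span_of_mul_mem_span 1 (monic_binomialElement hn (by decide)) ?_ hr
    simp only [Set.mem_singleton_iff, forall_eq]
    exact exists_C_binomialElement (by decide) (by decide)
  · refine mem_span_of_mul_mem_span 2 (monic_binomialElement hn (by decide)) ?_ hr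
    simp only [Set.mem_insert_iff, Set.mem_singleton_iff, forall_eq_or_imp, forall_eq]
    exact ⟨exists_C_binomialElement (by decide) (by decide),
      exists_C_binomialElement (by decide) (by decide)⟩

namespace IsRegularTriple

variable {R : Type*} [CommRing R] {d₁ d₂ d₃ : R} {b₀ b₁ b₂ b₃ : ℕ}
  {A : Matrix (Fin b₀) (Fin b₁) R} {B : Matrix (Fin b₁) (Fin b₂) R}
  {C : Matrix (Fin b₂) (Fin b₃) R}

theorem smul_left (h : IsRegularTriple d₁ d₂ d₃) {b : ℕ} {v : Fin b → R} (hv : d₁ • v = 0) :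
    v = 0 :=
  funext fun i => h.left _ (congrFun hv i)

theorem exists_smul_eq (h : IsRegularTriple d₁ d₂ d₃) {b : ℕ} {u v : Fin b → R}
    (huv : d₂ • u = d₁ • v) : ∃ w, u = d₁ • w := by
  have : ∀ i, ∃ w, u i = d₁ * w := fun i => h.middle _ ⟨v i, congrFun huv i⟩
  choose w hw using this
  exact ⟨w, funext hw⟩

theorem exists_smul_add_smul_eq (h : IsRegularTriple d₁ d₂ d₃) {b : ℕ} {u v w : Fin b → R}
    (huv : d₃ • u = d₁ • v + d₂ • w) : ∃ y z, u = d₁ • y + d₂ • z := by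
  have : ∀ i, ∃ y z, y * d₁ + z * d₂ = u i := fun i => by
    refine Ideal.mem_span_pair.1 (h.right _ (Ideal.mem_span_pair.2 ⟨v i, w i, ?_⟩))
    have := congrFun huv i
    simp only [Pi.smul_apply, Pi.add_apply, smul_eq_mul] at this
    rw [this]; ring
  choose y z hyz using this
  refine ⟨y, z, funext fun i => ?_⟩
  rw [← hyz i]
  simp [mul_comm]

/-- The lifts `u₁`, `u₂` of `d₁ v`, `d₂ v` satisfy `d₂ u₁ = d₁ u₂`, since `C` is injective. So `u₁ =
d₁ w`, and cancelling `d₁` gives `v = C w`. -/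
theorem exact_of_smul (h : IsRegularTriple d₁ d₂ d₃) (hBC : ∀ v, B.mulVec (C.mulVec v) = 0)
    (hC : ∀ v, C.mulVec v = 0 → v = 0)
    (h₁ : ∀ v, B.mulVec v = 0 → ∃ u, C.mulVec u = d₁ • v)
    (h₂ : ∀ v, B.mulVec v = 0 → ∃ u, C.mulVec u = d₂ • v) :
    Function.Exact C.mulVecLin B.mulVecLin := by
  intro v
  simp only [Matrix.mulVecLin_apply, Set.mem_range]
  refine ⟨fun hv => ?_, by rintro ⟨u, rfl⟩; exact hBC u⟩
  obtain ⟨u₁, hu₁⟩ := h₁ v hv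
  obtain ⟨u₂, hu₂⟩ := h₂ v hv
  have : d₂ • u₁ = d₁ • u₂ := by
    rw [← sub_eq_zero]
    apply hC
    rw [Matrix.mulVec_sub, Matrix.mulVec_smul, Matrix.mulVec_smul, hu₁, hu₂, smul_comm, sub_self]
  obtain ⟨w, rfl⟩ := h.exists_smul_eq this
  refine ⟨w, ?_⟩
  rw [← sub_eq_zero]
  apply h.smul_left
  rw [smul_sub, ← hu₁, Matrix.mulVec_smul, sub_self]

/-- The lifts now agree only up to the image of `C`. The corrections satisfy a Koszul cocycle
identity; the third regularity condition splits `w₁₂` as `d₁ y + d₂ z`, and `u₁ - C z` becomes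
divisible by `d₁`. -/
theorem exact_of_smul_of_exact (h : IsRegularTriple d₁ d₂ d₃)
    (hAB : ∀ v, A.mulVec (B.mulVec v) = 0) (hBC : Function.Exact C.mulVecLin B.mulVecLin)
    (hC : ∀ v, C.mulVec v = 0 → v = 0)
    (h₁ : ∀ v, A.mulVec v = 0 → ∃ u, B.mulVec u = d₁ • v)
    (h₂ : ∀ v, A.mulVec v = 0 → ∃ u, B.mulVec u = d₂ • v)
    (h₃ : ∀ v, A.mulVec v = 0 → ∃ u, B.mulVec u = d₃ • v) :
    Function.Exact B.mulVecLin A.mulVecLin := by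
  have hker : ∀ v, B.mulVec v = 0 → ∃ u, C.mulVec u = v := fun v hv => (hBC v).1 hv
  have hBC0 : ∀ v, B.mulVec (C.mulVec v) = 0 := fun v => (hBC (C.mulVec v)).2 ⟨v, rfl⟩
  intro v
  simp only [Matrix.mulVecLin_apply, Set.mem_range]
  refine ⟨fun hv => ?_, by rintro ⟨u, rfl⟩; exact hAB u⟩
  obtain ⟨u₁, hu₁⟩ := h₁ v hv
  obtain ⟨u₂, hu₂⟩ := h₂ v hv
  obtain ⟨u₃, hu₃⟩ := h₃ v hv
  obtain ⟨w₁₂, hw₁₂⟩ := hker (d₂ • u₁ - d₁ • u₂) (by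
    rw [Matrix.mulVec_sub, Matrix.mulVec_smul, Matrix.mulVec_smul, hu₁, hu₂, smul_comm, sub_self])
  obtain ⟨w₁₃, hw₁₃⟩ := hker (d₃ • u₁ - d₁ • u₃) (by
    rw [Matrix.mulVec_sub, Matrix.mulVec_smul, Matrix.mulVec_smul, hu₁, hu₃, smul_comm, sub_self])
  obtain ⟨w₂₃, hw₂₃⟩ := hker (d₃ • u₂ - d₂ • u₃) (by
    rw [Matrix.mulVec_sub, Matrix.mulVec_smul, Matrix.mulVec_smul, hu₂, hu₃, smul_comm, sub_self])
  have hcocycle : d₃ • w₁₂ = d₁ • (-w₂₃) + d₂ • w₁₃ := by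
    rw [← sub_eq_zero]
    apply hC
    simp only [Matrix.mulVec_sub, Matrix.mulVec_add, Matrix.mulVec_smul, Matrix.mulVec_neg, hw₁₂,
      hw₁₃, hw₂₃]
    module
  obtain ⟨y, z, rfl⟩ := h.exists_smul_add_smul_eq hcocycle
  rw [Matrix.mulVec_add, Matrix.mulVec_smul, Matrix.mulVec_smul] at hw₁₂
  have : d₂ • (u₁ - C.mulVec z) = d₁ • (u₂ + C.mulVec y) := by
    rw [smul_sub, smul_add, sub_eq_iff_eq_add, add_assoc, hw₁₂]
    abel
  obtain ⟨w, hw⟩ := h.exists_smul_eq this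
  refine ⟨w, ?_⟩
  rw [← sub_eq_zero]
  apply h.smul_left
  rw [smul_sub, ← hu₁, ← Matrix.mulVec_smul, ← hw, Matrix.mulVec_sub, hBC0, sub_zero, sub_self]

end IsRegularTriple

/-! ### The resolution -/

section Generators

variable {R : Type*} [CommRing R] {a x : Fin 4 → R} {f : Fin 6 → R}

theorem firstMatrix_eq (h : columnMinors a x = ![f 0, f 1, f 2, f 3, f 4, -f 5]) :
    firstMatrix a x = !![f 0, f 1, f 2, f 3, f 4, -f 5] := by
  rw [firstMatrix, h]
  simp only [Matrix.cons_val]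

theorem span_range_le_of_eq (h : columnMinors a x = ![f 0, f 1, f 2, f 3, f 4, -f 5])
    {J : Ideal R} (hJ : ∀ i, columnMinors a x i ∈ J) : Ideal.span (Set.range f) ≤ J := by
  rw [h] at hJ
  rw [Ideal.span_le]
  rintro _ ⟨i, rfl⟩
  have h5 := hJ 5
  simp only [Matrix.cons_val, neg_mem_iff] at h5
  fin_cases i
  exacts [hJ 0, hJ 1, hJ 2, hJ 3, hJ 4, h5]

theorem exact_firstMatrix (h : columnMinors a x = ![f 0, f 1, f 2, f 3, f 4, -f 5]) :
    Function.Exact (firstMatrix a x).mulVecLin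
      (fun v : Fin 1 → R => Ideal.Quotient.mk (Ideal.span (Set.range f)) (v 0)) := by
  have hform : ∀ v, (firstMatrix a x).mulVec v 0 =
      f 0 * v 0 + f 1 * v 1 + f 2 * v 2 + f 3 * v 3 + f 4 * v 4 - f 5 * v 5 := fun v => by
    rw [firstMatrix_mulVec, h]
    simp only [Matrix.cons_val]
    ring
  intro v
  simp only [Matrix.mulVecLin_apply, Set.mem_range, Ideal.Quotient.eq_zero_iff_mem]
  constructor
  · intro hv
    obtain ⟨c, hc⟩ := Ideal.mem_span_range_iff_exists_fun.1 hv
    refine ⟨![c 0, c 1, c 2, c 3, c 4, -c 5], ?_⟩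
    funext i
    rw [Subsingleton.elim i 0, hform, ← hc, Fin.sum_univ_six]
    simp only [Matrix.cons_val]
    ring
  · rintro ⟨u, rfl⟩
    rw [hform]
    have hm : ∀ i r, f i * r ∈ Ideal.span (Set.range f) :=
      fun i r => Ideal.mul_mem_right _ _ (Ideal.subset_span ⟨i, rfl⟩)
    exact sub_mem (add_mem (add_mem (add_mem (add_mem (hm _ _) (hm _ _)) (hm _ _)) (hm _ _))
      (hm _ _)) (hm _ _)

end Generators

section Resolution

variable {k : Type*} [Field k] {n α : Fin 4 → ℕ} {p : ℕ}

theorem columnMinors_eq (hα : ∀ i, 2 ≤ α i) :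
    columnMinors (fun i => (X i : MvPolynomial (Fin 4) k) ^ (α i - 1)) X =
      ![sixBinomials k α 0, sixBinomials k α 1, sixBinomials k α 2, sixBinomials k α 3,
        sixBinomials k α 4, -sixBinomials k α 5] := by
  have h : ∀ i, (X i : MvPolynomial (Fin 4) k) ^ (α i - 1) * X i = X i ^ α i := fun i => by
    rw [← pow_succ, Nat.sub_add_cancel (by have := hα i; omega)]
  simp only [columnMinors, sixBinomials, Matrix.cons_val, h, neg_sub]
  rw [mul_comm (X 3 ^ (α 3 - 1)) (X 0)]

theorem phi₁_eq (hα : ∀ i, 2 ≤ α i) :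
    phi₁ k α = firstMatrix (fun i => (X i : MvPolynomial (Fin 4) k) ^ (α i - 1)) X := by
  rw [phi₁]
  exact (firstMatrix_eq (columnMinors_eq hα)).symm

theorem phi₂_eq :
    phi₂ k α = secondMatrix (fun i => (X i : MvPolynomial (Fin 4) k) ^ (α i - 1)) X := by
  simp only [phi₂, secondMatrix]

theorem phi₃_eq :
    phi₃ k α = thirdMatrix (fun i => (X i : MvPolynomial (Fin 4) k) ^ (α i - 1)) X := by
  simp only [phi₃, thirdMatrix]

/-- The span of the six binomials is contained in every ideal which contains the minors. -/
theorem mem_of_columnMinors_mem (hα : ∀ i, 2 ≤ α i) {J : Ideal (MvPolynomial (Fin 4) k)}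
    (hJ : ∀ i, columnMinors (fun i => (X i : MvPolynomial (Fin 4) k) ^ (α i - 1)) X i ∈ J) :
    Ideal.span (Set.range (sixBinomials k α)) ≤ J :=
  span_range_le_of_eq (columnMinors_eq hα) hJ

/-- The multipliers carrying `v` into the image form an ideal, so it suffices to test the minors. -/
theorem exists_mulVec_eq_smul {b₁ b₂ : ℕ} {R : Type*} [CommRing R]
    (B : Matrix (Fin b₁) (Fin b₂) R) (v : Fin b₁ → R) :
    ∃ J : Ideal R, ∀ g, g ∈ J ↔ ∃ u, B.mulVec u = g • v :=
  ⟨(LinearMap.range B.mulVecLin).colon {v}, fun g => by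
    simp [Submodule.mem_colon_singleton]⟩

theorem exists_phi₂_eq_smul (hα : ∀ i, 2 ≤ α i) {g : MvPolynomial (Fin 4) k}
    (hg : g ∈ Ideal.span (Set.range (sixBinomials k α))) {v : Fin 6 → MvPolynomial (Fin 4) k}
    (hv : (phi₁ k α).mulVec v = 0) : ∃ u, (phi₂ k α).mulVec u = g • v := by
  obtain ⟨J, hJ⟩ := exists_mulVec_eq_smul (phi₂ k α) v
  rw [← hJ]
  refine mem_of_columnMinors_mem hα (fun i => ?_) hg
  rw [hJ, phi₂_eq]
  rw [phi₁_eq hα] at hv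
  exact exists_secondMatrix_of_minor hv i

theorem exists_phi₃_eq_smul (hα : ∀ i, 2 ≤ α i) {g : MvPolynomial (Fin 4) k}
    (hg : g ∈ Ideal.span (Set.range (sixBinomials k α))) {v : Fin 8 → MvPolynomial (Fin 4) k}
    (hv : (phi₂ k α).mulVec v = 0) : ∃ u, (phi₃ k α).mulVec u = g • v := by
  obtain ⟨J, hJ⟩ := exists_mulVec_eq_smul (phi₃ k α) v
  rw [← hJ]
  refine mem_of_columnMinors_mem hα (fun i => ?_) hg
  rw [hJ, phi₃_eq]
  rw [phi₂_eq] at hv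
  exact exists_thirdMatrix_of_minor hv i

theorem smul_eq_zero_of_phi₃ (hα : ∀ i, 2 ≤ α i) {g : MvPolynomial (Fin 4) k}
    (hg : g ∈ Ideal.span (Set.range (sixBinomials k α))) {v : Fin 3 → MvPolynomial (Fin 4) k}
    (hv : (phi₃ k α).mulVec v = 0) : g • v = 0 := by
  have := mem_of_columnMinors_mem hα
    (J := (⊥ : Submodule (MvPolynomial (Fin 4) k) (Fin 3 → MvPolynomial (Fin 4) k)).colon {v})
    (fun i => ?_) hg
  · simpa [Submodule.mem_colon_singleton] using this
  · rw [phi₃_eq] at hv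
    simpa [Submodule.mem_colon_singleton] using minor_smul_eq_zero hv i

theorem exact_phi₁ (hα : ∀ i, 2 ≤ α i)
    (hI : definingIdeal k n = Ideal.span (Set.range (sixBinomials k α))) :
    Function.Exact (phi₁ k α).mulVecLin
      (fun v : Fin 1 → MvPolynomial (Fin 4) k => Ideal.Quotient.mk (definingIdeal k n) (v 0)) := by
  rw [hI, phi₁_eq hα]
  exact exact_firstMatrix (columnMinors_eq hα)

end Resolution

/-! ### Degrees of the matrix entries -/

section Graded

variable {k : Type*} [Field k] {n : Fin 4 → ℕ} {p : ℕ} {a x : Fin 4 → MvPolynomial (Fin 4) k}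

/-- In each column the upper entry exceeds the lower one by `p` in degree, so every minor is
homogeneous. -/
theorem isGradedMatrix_firstMatrix (ha : ∀ i, IsWeightedHomogeneous n (a (i + 1)) (p + n i))
    (hx : ∀ i, IsWeightedHomogeneous n (x i) (n i)) :
    IsGradedMatrix n (fun _ => 0)
      ![p + n 3 + n 0, p + n 0 + n 1, p + n 1 + n 2, p + n 2 + n 3, p + n 3 + n 1, p + n 0 + n 2]
      (firstMatrix a x) := by
  have a0 : IsWeightedHomogeneous n (a 0) (p + n 3) := ha 3
  have a1 : IsWeightedHomogeneous n (a 1) (p + n 0) := ha 0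
  have a2 : IsWeightedHomogeneous n (a 2) (p + n 1) := ha 1
  have a3 : IsWeightedHomogeneous n (a 3) (p + n 2) := ha 2
  intro i j
  right
  obtain rfl : i = 0 := Subsingleton.elim _ _
  fin_cases j <;>
    simp only [firstMatrix, columnMinors, Matrix.of_apply, Matrix.cons_val, Fin.zero_eta,
      Fin.mk_one, Fin.reduceFinMk, Fin.isValue]
  · refine ⟨p + n 3 + n 0, rfl, (a0.mul (hx 0)).sub ?_⟩
    rw [add_right_comm]; exact a1.mul (hx 3)
  · refine ⟨p + n 0 + n 1, rfl, (a1.mul (hx 1)).sub ?_⟩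
    rw [add_right_comm]; exact a2.mul (hx 0)
  · refine ⟨p + n 1 + n 2, rfl, (a2.mul (hx 2)).sub ?_⟩
    rw [add_right_comm]; exact a3.mul (hx 1)
  · refine ⟨p + n 2 + n 3, rfl, (a3.mul (hx 3)).sub ?_⟩
    rw [add_right_comm]; exact a0.mul (hx 2)
  · refine ⟨p + n 3 + n 1, rfl, (a0.mul (hx 1)).sub ?_⟩
    rw [add_right_comm]; exact a2.mul (hx 3)
  · refine ⟨p + n 0 + n 2, rfl, (a1.mul (hx 2)).sub ?_⟩
    rw [add_right_comm]; exact a3.mul (hx 0)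

theorem isGradedMatrix_secondMatrix (ha : ∀ i, IsWeightedHomogeneous n (a (i + 1)) (p + n i))
    (hx : ∀ i, IsWeightedHomogeneous n (x i) (n i)) :
    IsGradedMatrix n
      ![p + n 3 + n 0, p + n 0 + n 1, p + n 1 + n 2, p + n 2 + n 3, p + n 3 + n 1, p + n 0 + n 2]
      ![2 * p + n 3 + n 0 + n 1, p + n 3 + n 0 + n 1, 2 * p + n 1 + n 2 + n 3, p + n 1 + n 2 + n 3,
        2 * p + n 0 + n 1 + n 2, p + n 0 + n 1 + n 2, 2 * p + n 0 + n 2 + n 3, p + n 0 + n 2 + n 3]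
      (secondMatrix a x) := by
  have a0 : IsWeightedHomogeneous n (a 0) (p + n 3) := ha 3
  have a1 : IsWeightedHomogeneous n (a 1) (p + n 0) := ha 0
  have a2 : IsWeightedHomogeneous n (a 2) (p + n 1) := ha 1
  have a3 : IsWeightedHomogeneous n (a 3) (p + n 2) := ha 2
  intro i j
  fin_cases i <;> fin_cases j <;>
    simp only [secondMatrix, Matrix.of_apply, Matrix.cons_val, Fin.zero_eta, Fin.mk_one,
      Fin.reduceFinMk, Fin.isValue, true_or] <;>
    right <;>
    first
      | exact ⟨_, by ring, a0⟩
      | exact ⟨_, by ring, a1⟩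
      | exact ⟨_, by ring, a2⟩
      | exact ⟨_, by ring, a3⟩
      | exact ⟨_, by ring, hx _⟩
      | exact ⟨_, by ring, a1.neg⟩
      | exact ⟨_, by ring, a2.neg⟩
      | exact ⟨_, by ring, (hx _).neg⟩

theorem isGradedMatrix_thirdMatrix (ha : ∀ i, IsWeightedHomogeneous n (a (i + 1)) (p + n i))
    (hx : ∀ i, IsWeightedHomogeneous n (x i) (n i)) :
    IsGradedMatrix n
      ![2 * p + n 3 + n 0 + n 1, p + n 3 + n 0 + n 1, 2 * p + n 1 + n 2 + n 3, p + n 1 + n 2 + n 3,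
        2 * p + n 0 + n 1 + n 2, p + n 0 + n 1 + n 2, 2 * p + n 0 + n 2 + n 3, p + n 0 + n 2 + n 3]
      ![p + n 0 + n 1 + n 2 + n 3, 3 * p + n 0 + n 1 + n 2 + n 3, 2 * p + n 0 + n 1 + n 2 + n 3]
      (thirdMatrix a x) := by
  have a0 : IsWeightedHomogeneous n (a 0) (p + n 3) := ha 3
  have a1 : IsWeightedHomogeneous n (a 1) (p + n 0) := ha 0
  have a2 : IsWeightedHomogeneous n (a 2) (p + n 1) := ha 1
  have a3 : IsWeightedHomogeneous n (a 3) (p + n 2) := ha 2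
  intro i j
  fin_cases i <;> fin_cases j <;>
    simp only [thirdMatrix, Matrix.transpose_apply, Matrix.of_apply, Matrix.cons_val,
      Fin.zero_eta, Fin.mk_one, Fin.reduceFinMk, Fin.isValue, true_or] <;>
    right <;>
    first
      | exact ⟨_, by ring, a0⟩
      | exact ⟨_, by ring, a1⟩
      | exact ⟨_, by ring, a2⟩
      | exact ⟨_, by ring, a3⟩
      | exact ⟨_, by ring, hx _⟩
      | exact ⟨_, by ring, a0.neg⟩
      | exact ⟨_, by ring, a1.neg⟩
      | exact ⟨_, by ring, a2.neg⟩
      | exact ⟨_, by ring, a3.neg⟩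
      | exact ⟨_, by ring, (hx _).neg⟩

theorem isGraded_eagonNorthcott (ha : ∀ i, IsWeightedHomogeneous n (a (i + 1)) (p + n i))
    (hx : ∀ i, IsWeightedHomogeneous n (x i) (n i)) :
    ∃ (d₁ : Fin 6 → ℕ) (d₂ : Fin 8 → ℕ) (d₃ : Fin 3 → ℕ),
      IsGradedMatrix n (fun _ => 0) d₁ (firstMatrix a x) ∧
      IsGradedMatrix n d₁ d₂ (secondMatrix a x) ∧ IsGradedMatrix n d₂ d₃ (thirdMatrix a x) :=
  ⟨_, _, _, isGradedMatrix_firstMatrix ha hx, isGradedMatrix_secondMatrix ha hx,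
    isGradedMatrix_thirdMatrix ha hx⟩

end Graded

/-! ### Minimality of the resolution -/

section Minimal

variable {R : Type*} [CommRing R] {a x : Fin 4 → R} {J : Ideal R}

theorem firstMatrix_mem (hx : ∀ i, x i ∈ J) (i : Fin 1) (j : Fin 6) : firstMatrix a x i j ∈ J := by
  have h : ∀ r s t u : Fin 4, a r * x s - a t * x u ∈ J := fun r s t u =>
    sub_mem (Ideal.mul_mem_left _ _ (hx s)) (Ideal.mul_mem_left _ _ (hx u))
  obtain rfl : i = 0 := Subsingleton.elim _ _
  fin_cases j
  exacts [h 0 0 1 3, h 1 1 2 0, h 2 2 3 1, h 3 3 0 2, h 0 1 2 3, h 1 2 3 0]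

theorem secondMatrix_mem (ha : ∀ i, a i ∈ J) (hx : ∀ i, x i ∈ J) (i : Fin 6) (j : Fin 8) :
    secondMatrix a x i j ∈ J := by
  fin_cases i <;> fin_cases j <;> simp [secondMatrix, ha, hx]

theorem thirdMatrix_mem (ha : ∀ i, a i ∈ J) (hx : ∀ i, x i ∈ J) (i : Fin 8) (j : Fin 3) :
    thirdMatrix a x i j ∈ J := by
  fin_cases i <;> fin_cases j <;> simp [thirdMatrix, ha, hx]

end Minimal

theorem IsCyclicWeight.isMinimalFreeResolution {k : Type*} [Field k] {n α : Fin 4 → ℕ} {p : ℕ}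
    (h : IsCyclicWeight n α p)
    (hI : definingIdeal k n = Ideal.span (Set.range (sixBinomials k α))) :
    IsMinimalFreeResolution n (definingIdeal k n) (phi₁ k α) (phi₂ k α) (phi₃ k α) := by
  have hα := h.two_le
  have hd := isRegularTriple_binomialElement k (h.pos 3)
  have hmem : ∀ i, binomialElement k n i ∈ Ideal.span (Set.range (sixBinomials k α)) := fun i =>
    hI ▸ binomialElement_mem k n i
  have h₁₂ : ∀ v, (phi₁ k α).mulVec ((phi₂ k α).mulVec v) = 0 := fun v => by
    rw [phi₁_eq hα, phi₂_eq]
    exact firstMatrix_mulVec_secondMatrix _ _ v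
  have h₂₃ : ∀ v, (phi₂ k α).mulVec ((phi₃ k α).mulVec v) = 0 := fun v => by
    rw [phi₂_eq, phi₃_eq]
    exact secondMatrix_mulVec_thirdMatrix _ _ v
  have h₃ : ∀ v, (phi₃ k α).mulVec v = 0 → v = 0 := fun v hv =>
    hd.smul_left (smul_eq_zero_of_phi₃ hα (hmem 0) hv)
  have hexact : Function.Exact (phi₃ k α).mulVecLin (phi₂ k α).mulVecLin :=
    hd.exact_of_smul h₂₃ h₃ (fun _ => exists_phi₃_eq_smul hα (hmem 0))
      (fun _ => exists_phi₃_eq_smul hα (hmem 1))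
  have hX : ∀ i, (X i : MvPolynomial (Fin 4) k) ∈ Ideal.span (Set.range X) := fun i =>
    Ideal.subset_span ⟨i, rfl⟩
  have hXpow : ∀ i, (X i : MvPolynomial (Fin 4) k) ^ (α i - 1) ∈ Ideal.span (Set.range X) :=
    fun i => Ideal.pow_mem_of_mem _ (hX i) _ (by have := hα i; omega)
  have hdX : ∀ i, IsWeightedHomogeneous n (X i : MvPolynomial (Fin 4) k) (n i) :=
    isWeightedHomogeneous_X k n
  have hdpow : ∀ i, IsWeightedHomogeneous n
      ((X (i + 1) : MvPolynomial (Fin 4) k) ^ (α (i + 1) - 1)) (p + n i) := fun i => by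
    rw [← h.eq i]
    exact (hdX (i + 1)).pow _
  have hgraded := isGraded_eagonNorthcott
    (a := fun i => (X i : MvPolynomial (Fin 4) k) ^ (α i - 1)) hdpow hdX
  rw [← phi₁_eq hα, ← phi₂_eq, ← phi₃_eq] at hgraded
  refine ⟨exact_phi₁ hα hI, ?_, hexact, ?_, hgraded, ?_, ?_, ?_⟩
  · exact hd.exact_of_smul_of_exact h₁₂ hexact h₃ (fun _ => exists_phi₂_eq_smul hα (hmem 0))
      (fun _ => exists_phi₂_eq_smul hα (hmem 1)) (fun _ => exists_phi₂_eq_smul hα (hmem 2))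
  · exact (injective_iff_map_eq_zero _).2 h₃
  · rw [phi₁_eq hα]; exact firstMatrix_mem hX
  · rw [phi₂_eq]; exact secondMatrix_mem hXpow hX
  · rw [phi₃_eq]; exact thirdMatrix_mem hXpow hX

theorem exists_isNatComb_of_le {S : AddSubmonoid ℕ} (hS : IsNumericalSemigroup S) {n : Fin 4 → ℕ}
    (hn : IsMinimalGenerators S n) (σ : Equiv.Perm (Fin 4)) :
    ∃ N : ℕ, ∀ a : ℕ, N ≤ a → IsNatComb (n ∘ σ) a := by
  obtain ⟨N, hN⟩ := Set.Finite.bddAbove hS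
  refine ⟨N + 1, fun a ha => ?_⟩
  rw [← mem_closure_range_iff_isNatComb, σ.surjective.range_comp, ← hn.1]
  by_contra hc
  have := hN hc
  omega

/-- The cycle may belong to `q`; then the two numbers change roles. -/
theorem FrobeniusPair.exists_perm {n α : Fin 4 → ℕ} {p q : ℤ} (h : FrobeniusPair n α p q) :
    ∃ (σ : Equiv.Perm (Fin 4)) (p' : ℤ), FrobeniusPair (n ∘ σ) (α ∘ σ) p' (2 * p') ∧
      ∀ i, p' + (n ∘ σ) i = ((α ∘ σ) (i + 1) - 1 : ℤ) * (n ∘ σ) (i + 1) := by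
  have key : ∀ {p q : ℤ} (σ : Equiv.Perm (Fin 4)), FrobeniusPair n α p q →
      HasArcs (n ∘ σ) p (fun i j => j == i + 1) → FrobeniusPair (n ∘ σ) (α ∘ σ) p (2 * p) ∧
      ∀ i, p + (n ∘ σ) i = ((α ∘ σ) (i + 1) - 1 : ℤ) * (n ∘ σ) (i + 1) := by
    intro p q σ h hT
    have hlab : ∀ i : Fin 4, IsLabelling i (i + 1) (i + 2) (i + 3) := by decide
    have h₂ : ∀ i : Fin 4, (i + 2 == i + 1) = false := by decide
    have h₃ : ∀ i : Fin 4, (i + 3 == i + 1) = false := by decide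
    have hσ := h.comp σ
    exact ⟨hσ.right_eq_two_mul hT ▸ hσ, fun i => hT.single hσ (hlab i) (h₂ i) (h₃ i)⟩
  obtain ⟨σ, hT | hT⟩ := h.exists_cycle
  exacts [⟨σ, p, key σ h hT⟩, ⟨σ, q, key σ h.symm hT⟩]

theorem corollary5p5 (S : AddSubmonoid ℕ) (hS : IsNumericalSemigroup S)
    (n : Fin 4 → ℕ) (hn : IsMinimalGenerators S n) (hodd : ∀ i, Odd (n i))
    (has : IsAlmostSymmetric S) (ht : semigroupType S = 3) :
    ∃ (σ : Equiv.Perm (Fin 4)) (m α : Fin 4 → ℕ),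
      m = n ∘ σ ∧ α = alphaNumber m ∧
      (∀ i, m i = (α (i + 1) - 1) * (α (i + 2) - 1) * α (i + 3) + α (i + 1)) ∧
      (∀ i, Odd (α i)) ∧
      ∀ (k : Type*) [Field k],
        definingIdeal k m = Ideal.span (Set.range (sixBinomials k α)) ∧
        IsMinimalFreeResolution m (definingIdeal k m) (phi₁ k α) (phi₂ k α) (phi₃ k α) := by
  obtain ⟨p, q, h⟩ := exists_frobeniusPair hS hn hodd has ht
  obtain ⟨σ, p, h, hp⟩ := h.exists_perm
  rw [← alphaNumber_comp] at h hp
  -- The Frobenius number `3p` is odd.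
  have hodd_p : Odd p := by
    have := h.odd_add
    rw [show p + 2 * p = 3 * p by ring, Int.odd_mul] at this
    exact this.2
  refine ⟨σ, n ∘ σ, alphaNumber (n ∘ σ), rfl, rfl,
    h.gen_eq hp rfl (exists_isNatComb_of_le hS hn σ), fun i => ?_, fun k _ => ?_⟩
  · have := (h.odd_alpha_iff (hp (i - 1))).1 hodd_p
    rw [sub_add_cancel] at this
    exact_mod_cast this
  · have hI := definingIdeal_eq_span h hp rfl k
    exact ⟨hI, (h.isCyclicWeight hp).2.isMinimalFreeResolution hI⟩
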